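/- For $\lambda$ in the open unit disk $\mathbb{D}$ let $\mathsf{A}_\lambda=\{\sum_{n\ge 0}a_n\lambda^n : a_n\in\{-1,+1\}\}$, and let $\mathcal{M}=\{\lambda\in\mathbb{D} : \mathsf{A}_\lambda \text{ is connected}\}$ and $\mathcal{M}_0=\{\lambda\in\mathbb{D} : 0\in\mathsf{A}_\lambda\}$. Let $\mathcal{P}$ be the set of power series $f(z)=\sum_{j\ge 0}c_jz^j$ with $c_0=1$ and all $c_j\in\{-1,0,1\}$, and let $\mathcal{F}_\lambda=\{f\in\mathcal{P} : f(\lambda)=0\}$. A series $f\in\mathcal{P}$ is of rational type $(\ell,p)$ if $\ell\ge 0$ and $p\ge 1$ are the minimal integers such that $$f(z)=\sum_{j=0}^{\ell}c_jz^j+\frac{c_{\ell+1}z^{\ell+1}+\dots+c_{\ell+p}z^{\ell+p}}{1-z^p}.$$ Theorem. Let $\lambda\in\mathcal{M}\setminus\mathbb{R}$ with $|\lambda|\le 2^{-1/2}$ be such that $\mathcal{F}_\lambda=\{f\}$, where $f(z)=\sum_{j\ge0}c_jz^j$ is of rational type $(\ell,p)$ and has no zero coefficients. Write $f_k(z)=\sum_{j=0}^kc_jz^j$,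 and suppose that for every $0\le n\le p-1$: (i) $\displaystyle |f_{\ell+1+n}(\lambda)|>\frac12\,\frac{|\lambda^{\ell+n+2}|}{1-|\lambda|}$; (ii) $\displaystyle |f_{\ell+1+n}(\lambda)|+|f_{\ell+2+n}(\lambda)|>\frac{|\lambda^{\ell+n+2}|}{1-|\lambda|}$; (iii') if $Q$ is the polynomial with $f_\ell(z)+z^{\ell+1}Q(z)=f_{\ell+1+n}(z)$, then $|f_{\ell+1+n}(\lambda)|<|f_\ell(\lambda)+\lambda^{\ell+1}P(\lambda)|$ for every polynomial $P\ne Q$ of degree at most $n$ (including $P=0$) with coefficients in $\{-1,0,1\}$. Then $\lambda\in\partial\mathcal{M}_0$, and $\lambda$ is accessible from a connected component $U$ of $\mathbb{D}\setminus\mathcal{M}_0$: there is a continuous $\gamma:[0,1]\to\mathbb{C}$ with $\gamma(t)\in U$ for $0\le t<1$ and $\gamma(1)=\lambda$. -/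

import Mathlib

noncomputable section

namespace ThurstonSet

/-- The open unit disk `𝔻` in the complex plane. -/
def unitDisk : Set ℂ := Metric.ball 0 1

/-- The set `A_λ` of all sums `∑ aₙ λⁿ` with `aₙ ∈ {-1, 1}`, which for `|λ| < 1` is the attractor of
the iterated function system `{z ↦ -1 + λ z, z ↦ 1 + λ z}`. -/
def attractor (lam : ℂ) : Set ℂ :=
  {w | ∃ a : ℕ → ℂ, (∀ n, a n = -1 ∨ a n = 1) ∧ w = ∑' n, a n * lam ^ n}

/-- The connectivity locus `𝓜`. -/
def connectivityLocus : Set ℂ := {lam | lam ∈ unitDisk ∧ IsConnected (attractor lam)}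

/-- The Thurston set `𝓜₀`. -/
def thurstonSet : Set ℂ := {lam | lam ∈ unitDisk ∧ (0 : ℂ) ∈ attractor lam}

/-- The set `𝓟` of power series with coefficients in `{-1, 0, 1}` and constant coefficient `1`. -/
def normalizedSeries : Set (PowerSeries ℤ) :=
  {f | PowerSeries.coeff 0 f = 1 ∧
    ∀ j, PowerSeries.coeff j f = -1 ∨ PowerSeries.coeff j f = 0 ∨ PowerSeries.coeff j f = 1}

/-- The sum `f(z) = ∑ cⱼ zʲ` of a power series with bounded integer coefficients, for `|z| < 1`. -/
def seriesValue (f : PowerSeries ℤ) (z : ℂ) : ℂ :=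
  ∑' j, ((PowerSeries.coeff j f : ℤ) : ℂ) * z ^ j

/-- The set `𝓕_λ` of those members of `𝓟` that vanish at `λ`. -/
def vanishingSeries (lam : ℂ) : Set (PowerSeries ℤ) :=
  {f | f ∈ normalizedSeries ∧ seriesValue f lam = 0}

/-- The Taylor polynomial `f_k(z) = ∑_{j ≤ k} cⱼ zʲ`. -/
def taylorPoly (f : PowerSeries ℤ) (k : ℕ) : Polynomial ℤ := PowerSeries.trunc (k + 1) f

/-- `f(z) = ∑_{j=0}^ℓ cⱼ zʲ + (c_{ℓ+1} z^{ℓ+1} + ⋯ + c_{ℓ+p} z^{ℓ+p}) / (1 - z^p)` with `p ≥ 1`, as an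
identity of formal power series (with the denominator cleared). -/
def HasRationalForm (f : PowerSeries ℤ) (l p : ℕ) : Prop :=
  0 < p ∧
    (f - (taylorPoly f l : PowerSeries ℤ)) * (1 - PowerSeries.X ^ p) =
      ∑ j ∈ Finset.Icc (l + 1) (l + p), PowerSeries.C (PowerSeries.coeff j f) * PowerSeries.X ^ j

/-- `f` is of rational type `(ℓ, p)`: the integers `ℓ` and `p` are minimal with
`HasRationalForm f ℓ p`. -/
def IsRationalType (f : PowerSeries ℤ) (l p : ℕ) : Prop :=
  HasRationalForm f l p ∧ ∀ l' p', HasRationalForm f l' p' → l ≤ l' ∧ p ≤ p'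

/-- `U` is a connected component of the subspace `S`. -/
def IsComponentOf (U S : Set ℂ) : Prop := ∃ x ∈ S, U = connectedComponentIn S x

/-- `z` is path accessible from `U`: some path ends at `z` and lies in `U` before its endpoint. -/
def IsAccessibleFrom (z : ℂ) (U : Set ℂ) : Prop :=
  ∃ γ : ℝ → ℂ, ContinuousOn γ (Set.Icc 0 1) ∧ (∀ t ∈ Set.Ico (0 : ℝ) 1, γ t ∈ U) ∧ γ 1 = z

end ThurstonSet

end

/-! Let `c` be the coefficient sequence of f. A sign series `a` with `a 0 = 1` that vanishes at a
point z near λ satisfies f - a = 2e, where e arises from f by deleting terms, so f(z)/2 = e(z). If a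
departs from f within the preperiod, uniqueness of f and compactness keep a(λ), hence a(z), away
from 0. Otherwise e starts late, at z^j say, and e(z) differs from e(λ) by little compared with
|λ|^j. So z can lie in the Thurston set only if f(z)/2 is, up to a small relative error, a sub-sum
at λ of a tail of f (`eventually_series_ne_zero`). It therefore suffices to find a curve spiralling
into 0 whose distance from such sub-sums is comparable to its norm (`exists_spiral`), and to pull it
back by f, which is a power in a local coordinate at λ (`exists_local_root`).

Extending the periodic tail of f backwards turns the sub-sums into a closed set X (`locus`)
invariant under λ^p. If a point has two representations, one using the first available term and one
not, then their difference is, up to sign and a power of λ, a normalized vanishing series, hence f.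
So the two halves of every cylinder share exactly one point (`cyl_inter`), and cylinders behave like
trees: they are connected, have empty interior, and carry a continuous logarithm of every
nonvanishing continuous function. X minus 0 is a union of such pieces, and two pieces meet in at
most one point (`piece_inter`).

For the spiral it is enough to join x/ν to x off X, where ν = λ^(pN), and to repeat that path under
scaling. By Eilenberg's criterion, applied after an inversion sending x to infinity, this follows
once (z - x/ν)/(z - x) has a continuous logarithm on X with a limit at infinity. If L is a logarithm
of z - x on X, then L(νz) - L(z) is a logarithm of this quotient up to the factor ν. It converges at
infinity provided that the logarithm of z grows by the same amount from z to νz along every strand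
of X (`rot_eq`). For strands that meet this is immediate. For disjoint strands it comes from a
logarithm of z - z' on their product: disjoint curves that are both invariant under z ↦ νz must turn
at the same rate. -/

noncomputable section

open Set Filter Topology

namespace ThurstonSet

/-! ### Continuous logarithms and Eilenberg's criterion. -/

section Logarithms

variable {α β : Type*} [TopologicalSpace α] [TopologicalSpace β]

/-- `h` has a continuous logarithm on `K`. -/
def HasLogOn (h : α → ℂ) (K : Set α) : Prop :=
  ∃ L : α → ℂ, ContinuousOn L K ∧ ∀ z ∈ K, Complex.exp (L z) = h z

/-- Every continuous nonvanishing function on `K` has a continuous logarithm. -/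
def LogAcyclic (K : Set α) : Prop :=
  ∀ h : α → ℂ, ContinuousOn h K → (∀ z ∈ K, h z ≠ 0) → HasLogOn h K

lemma countable_exp_fiber (w : ℂ) : {u : ℂ | Complex.exp u = w}.Countable := by
  by_cases hw : ∃ u, Complex.exp u = w
  · obtain ⟨u, rfl⟩ := hw
    refine (countable_range fun n : ℤ => u + n * (2 * Real.pi * Complex.I)).mono ?_
    intro v hv
    obtain ⟨n, hn⟩ := Complex.exp_eq_exp_iff_exists_int.1 hv
    exact ⟨n, hn.symm⟩
  · convert! countable_empty
    ext u
    simpa using fun h => hw ⟨u, h⟩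

/-- The image of `S` is preconnected and contained in a countable fibre of `exp`, so it is a point.
All rigidity of logarithms below rests on this. -/
lemma eq_of_exp_eq_const {S : Set α} (hS : IsPreconnected S) {f : α → ℂ} {w : ℂ}
    (hf : ContinuousOn f S) (hw : ∀ z ∈ S, Complex.exp (f z) = w) {x y : α} (hx : x ∈ S)
    (hy : y ∈ S) : f x = f y := by
  have hc : (f '' S).Countable := (countable_exp_fiber w).mono (by
    rintro _ ⟨z, hz, rfl⟩; exact hw z hz)
  exact hc.isTotallyDisconnected _ subset_rfl (hS.image f hf) ⟨x, hx, rfl⟩ ⟨y, hy, rfl⟩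

lemma sub_eq_sub_of_logs {S : Set α} (hS : IsPreconnected S) {f g h : α → ℂ}
    (hf : ContinuousOn f S) (hg : ContinuousOn g S) (hfh : ∀ z ∈ S, Complex.exp (f z) = h z)
    (hgh : ∀ z ∈ S, Complex.exp (g z) = h z) {x y : α} (hx : x ∈ S) (hy : y ∈ S) :
    f x - g x = f y - g y := by
  refine eq_of_exp_eq_const (f := fun z => f z - g z) (w := 1) hS (hf.sub hg) (fun z hz => ?_) hx hy
  have : h z ≠ 0 := hfh z hz ▸ Complex.exp_ne_zero _
  simp only [Complex.exp_sub, hfh z hz, hgh z hz, div_self this]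

/-- At a common point `a` the two logarithms differ by a period of `exp`; adding that period to one
of them makes them agree there, and there is no other point to check. -/
lemma HasLogOn.union {h : α → ℂ} {K K' : Set α} (hK : IsClosed K) (hK' : IsClosed K')
    (H : HasLogOn h K) (H' : HasLogOn h K') {a : α} (ha : K ∩ K' ⊆ {a}) :
    HasLogOn h (K ∪ K') := by
  classical
  obtain ⟨L, hL, e⟩ := H
  obtain ⟨L', hL', e'⟩ := H'
  by_cases hne : a ∈ K ∩ K'
  · let M : α → ℂ := fun z => if z ∈ K then L z else L' z + (L a - L' a)
    have hMK : ∀ z ∈ K, M z = L z := fun z hz => if_pos hz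
    have hMK' : ∀ z ∈ K', M z = L' z + (L a - L' a) := by
      intro z hz
      by_cases hzK : z ∈ K
      · have : z = a := ha ⟨hzK, hz⟩
        simp only [M, if_pos hzK]
        rw [this]; ring
      · exact if_neg hzK
    refine ⟨M, ContinuousOn.union_of_isClosed (hL.congr hMK)
      ((hL'.add continuousOn_const).congr hMK') hK hK', ?_⟩
    rintro z (hz | hz)
    · rw [hMK z hz, e z hz]
    · rw [hMK' z hz, Complex.exp_add, Complex.exp_sub, e' z hz, e a hne.1, e' a hne.2,
        div_self, mul_one]
      exact e a hne.1 ▸ Complex.exp_ne_zero _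
  · have hd : ∀ z ∈ K', z ∉ K := fun z hz hzK => hne (by
      have := ha ⟨hzK, hz⟩
      rw [mem_singleton_iff] at this
      exact this ▸ ⟨hzK, hz⟩)
    let M : α → ℂ := fun z => if z ∈ K then L z else L' z
    have hMK : ∀ z ∈ K, M z = L z := fun z hz => if_pos hz
    have hMK' : ∀ z ∈ K', M z = L' z := fun z hz => if_neg (hd z hz)
    refine ⟨M, ContinuousOn.union_of_isClosed (hL.congr hMK) (hL'.congr hMK') hK hK', ?_⟩
    rintro z (hz | hz)
    · rw [hMK z hz, e z hz]
    · rw [hMK' z hz, e' z hz]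

lemma div_mem_slitPlane {u v : ℂ} (h : ‖u - v‖ < ‖v‖) : u / v ∈ Complex.slitPlane := by
  have hv : v ≠ 0 := by
    rintro rfl
    simp at h
    exact absurd h (not_lt.2 (norm_nonneg _))
  have : ‖u / v - 1‖ < 1 := by
    rw [div_sub_one hv, norm_div, div_lt_one (norm_pos_iff.2 hv)]
    exact h
  have h2 := Complex.mem_slitPlane_of_norm_lt_one this
  simpa using h2

lemma hasLogOn_of_norm_sub_lt {h : α → ℂ} {K : Set α} (hc : ContinuousOn h K) {v : ℂ}
    (hv : ∀ z ∈ K, ‖h z - v‖ < ‖v‖) : HasLogOn h K := by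
  refine ⟨fun z => Complex.log (h z / v) + Complex.log v, ?_, ?_⟩
  · exact ((hc.div_const v).clog fun z hz => div_mem_slitPlane (hv z hz)).add continuousOn_const
  · intro z hz
    have hs := Complex.slitPlane_ne_zero (div_mem_slitPlane (hv z hz))
    have hv0 : v ≠ 0 := by rintro rfl; simp at hs
    rw [Complex.exp_add, Complex.exp_log hs, Complex.exp_log hv0, div_mul_cancel₀ _ hv0]

/-- Take a logarithm along the slice `{a} × K'`, then logarithms along the slices `K × {y}`
normalized to vanish at `a`. Connectedness of `K` makes the latter unique, and compactness of `K`
makes them vary continuously with `y`. -/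
lemma LogAcyclic.prod {K : Set α} {K' : Set β} (hK : IsCompact K) (hKc : IsPreconnected K)
    (hKne : K.Nonempty) (H : LogAcyclic K) (H' : LogAcyclic K') : LogAcyclic (K ×ˢ K') := by
  intro h hh h0
  obtain ⟨a, ha⟩ := hKne
  obtain ⟨A, hA, eA⟩ := H' (fun y => h (a, y))
    (hh.comp (by fun_prop) fun y hy => ⟨ha, hy⟩) (fun y hy => h0 _ ⟨ha, hy⟩)
  have key : ∀ y ∈ K', ∃ L : α → ℂ, ContinuousOn L K ∧ L a = 0 ∧
      ∀ z ∈ K, Complex.exp (L z) = h (z, y) / h (a, y) := by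
    intro y hy
    obtain ⟨L, hL, eL⟩ := H (fun z => h (z, y) / h (a, y))
      ((hh.comp (f := fun z => (z, y)) (by fun_prop) fun z hz => ⟨hz, hy⟩).div_const _)
      (fun z hz => div_ne_zero (h0 _ ⟨hz, hy⟩) (h0 _ ⟨ha, hy⟩))
    refine ⟨fun z => L z - L a, hL.sub continuousOn_const, sub_self _, fun z hz => ?_⟩
    rw [Complex.exp_sub, eL z hz, eL a ha]
    simp only [div_self (h0 (a, y) ⟨ha, hy⟩), div_one]
  choose! L hL hLa hLe using key
  refine ⟨fun q => A q.2 + L q.2 q.1, ?_, ?_⟩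
  swap
  · rintro ⟨z, y⟩ ⟨hz, hy⟩
    rw [Complex.exp_add, eA y hy, hLe y hy z hz]
    exact mul_div_cancel₀ _ (h0 (a, y) ⟨ha, hy⟩)
  rintro ⟨z₁, y₁⟩ ⟨hz₁, hy₁⟩
  simp only at hz₁ hy₁
  let r : α × β → ℂ := fun q => h q / h (a, q.2)
  have hr : ContinuousOn r (K ×ˢ K') :=
    hh.div (hh.comp (by fun_prop) fun q hq => ⟨ha, hq.2⟩) (fun q hq => h0 _ ⟨ha, hq.2⟩)
  -- `u` is 1 on the slice `y = y₁`, so by compactness of `K` it stays in the slit plane on all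
  -- nearby slices, where the principal logarithm applies.
  let u : α × β → ℂ := fun q => r q / r (q.1, y₁)
  have hr0 : ∀ q ∈ K ×ˢ K', r q ≠ 0 := fun q hq => div_ne_zero (h0 _ hq) (h0 _ ⟨ha, hq.2⟩)
  have hu : ContinuousOn u (K ×ˢ K') :=
    hr.div (hr.comp (by fun_prop) fun q hq => ⟨hq.1, hy₁⟩) (fun q hq => hr0 _ ⟨hq.1, hy₁⟩)
  have hev : ∀ᶠ y in 𝓝[K'] y₁, ∀ z ∈ K, u (z, y) ∈ Complex.slitPlane := by
    have h1 : ∀ z ∈ K, ∀ᶠ q in 𝓝 (y₁, z), q.1 ∈ K' → q.2 ∈ K → u (q.2, q.1) ∈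
        Complex.slitPlane := by
      intro z hz
      have h2 : ContinuousWithinAt (fun q : β × α => u (q.2, q.1)) (K' ×ˢ K) (y₁, z) :=
        (hu.comp (f := fun q : β × α => (q.2, q.1)) (by fun_prop)
          fun q hq => ⟨hq.2, hq.1⟩) (y₁, z) ⟨hy₁, hz⟩
      have h3 : u (z, y₁) ∈ Complex.slitPlane := by
        simp only [u]
        rw [div_self (hr0 _ ⟨hz, hy₁⟩)]
        exact Complex.one_mem_slitPlane
      have h4 := h2.eventually (Complex.isOpen_slitPlane.mem_nhds h3)
      rw [eventually_nhdsWithin_iff] at h4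
      filter_upwards [h4] with q hq h5 h6 using hq ⟨h5, h6⟩
    rw [eventually_nhdsWithin_iff]
    have := hK.eventually_forall_of_forall_eventually (x₀ := y₁) (P := fun y z => y ∈ K' → z ∈ K →
      u (z, y) ∈ Complex.slitPlane) h1
    filter_upwards [this] with y hy h5 z hz using hy z hz h5 hz
  -- Both sides are logarithms of the same function on the slice at `y` and both vanish at `a`.
  have heq : ∀ᶠ y in 𝓝[K'] y₁, ∀ z ∈ K, L y z = L y₁ z + Complex.log (u (z, y)) := by
    filter_upwards [hev, self_mem_nhdsWithin] with y hy hyK z hz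
    have h1 : ∀ w ∈ K, Complex.exp (L y₁ w + Complex.log (u (w, y))) = h (w, y) / h (a, y) := by
      intro w hw
      rw [Complex.exp_add, Complex.exp_log (Complex.slitPlane_ne_zero (hy w hw)),
        hLe y₁ hy₁ w hw]
      exact mul_div_cancel₀ _ (hr0 (w, y₁) ⟨hw, hy₁⟩)
    have h2 := sub_eq_sub_of_logs hKc (hL y hyK) ((hL y₁ hy₁).add
      ((hu.comp (f := fun w => (w, y)) (by fun_prop) fun w hw => ⟨hw, hyK⟩).clog hy))
      (hLe y hyK) h1 hz ha
    have h3 : u (a, y) = 1 := by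
      simp only [u, r]
      rw [div_self (h0 _ ⟨ha, hyK⟩), div_self (h0 _ ⟨ha, hy₁⟩), div_one]
    simp only [Pi.add_apply, Function.comp_apply, h3, hLa y hyK, hLa y₁ hy₁, Complex.log_one] at h2
    linear_combination h2
  have h1 : ContinuousWithinAt (fun q : α × β => A q.2 + (L y₁ q.1 + Complex.log (u q)))
      (K ×ˢ K') (z₁, y₁) := by
    refine ContinuousWithinAt.add ?_ (ContinuousWithinAt.add ?_ ?_)
    · exact (hA y₁ hy₁).comp (by fun_prop) fun q hq => hq.2
    · exact (hL y₁ hy₁ z₁ hz₁).comp (f := fun q : α × β => q.1) (by fun_prop) fun q hq => hq.1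
    · refine (hu (z₁, y₁) ⟨hz₁, hy₁⟩).clog ?_
      simp only [u]
      rw [div_self (hr0 _ ⟨hz₁, hy₁⟩)]
      exact Complex.one_mem_slitPlane
  refine h1.congr_of_eventuallyEq_of_mem ?_ ⟨hz₁, hy₁⟩
  have h5 : Tendsto (fun q : α × β => q.2) (𝓝[K ×ˢ K'] (z₁, y₁)) (𝓝[K'] y₁) :=
    tendsto_nhdsWithin_of_tendsto_nhds_of_eventually_within _
      (continuous_snd.continuousAt.tendsto.mono_left nhdsWithin_le_nhds)
      (by filter_upwards [self_mem_nhdsWithin] with q hq using hq.2)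
  filter_upwards [h5.eventually heq, self_mem_nhdsWithin] with q hq hqK
  rw [hq q.1 hqK.1]

lemma isSimplyConnected_univ (E : Type*) [AddCommGroup E] [Module ℝ E] [TopologicalSpace E]
    [ContinuousAdd E] [ContinuousSMul ℝ E] : IsSimplyConnected (univ : Set E) := by
  have := (convex_univ (𝕜 := ℝ) (E := E)).contractibleSpace univ_nonempty
  show SimplyConnectedSpace (univ : Set E)
  infer_instance

lemma exists_log_of_ne_zero_plane {h : ℂ → ℂ} (hc : Continuous h) (h0 : ∀ z, h z ≠ 0) :
    ∃ L : ℂ → ℂ, Continuous L ∧ ∀ z, Complex.exp (L z) = h z := by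
  obtain ⟨L, hL, e⟩ := Complex.exists_continuousOn_eqOn_exp_comp (X := ℂ) (U := univ)
    (isSimplyConnected_univ _) isOpen_univ hc.continuousOn (by
      rintro ⟨z, -, hz⟩; exact h0 z hz)
  exact ⟨L, continuousOn_univ.1 hL, fun z => e (mem_univ z)⟩

lemma exists_log_of_ne_zero_line {h : ℝ → ℂ} (hc : Continuous h) (h0 : ∀ z, h z ≠ 0) :
    ∃ L : ℝ → ℂ, Continuous L ∧ ∀ z, Complex.exp (L z) = h z := by
  obtain ⟨L, hL, e⟩ := Complex.exists_continuousOn_eqOn_exp_comp (X := ℝ) (U := univ)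
    (isSimplyConnected_univ _) isOpen_univ hc.continuousOn (by
      rintro ⟨z, -, hz⟩; exact h0 z hz)
  exact ⟨L, continuousOn_univ.1 hL, fun z => e (mem_univ z)⟩

/-- Eilenberg's criterion: if `w - q` has a continuous logarithm on the compact set `K`, then
`q` lies in the unbounded component of the complement of `K`. -/
theorem not_isBounded_component_of_hasLogOn {K : Set ℂ} (hK : IsCompact K) {q : ℂ} (hq : q ∉ K)
    (H : HasLogOn (fun w => w - q) K) :
    ¬ Bornology.IsBounded (connectedComponentIn Kᶜ q) := by
  classical
  intro hb
  set V := connectedComponentIn Kᶜ q with hV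
  have hVo : IsOpen V := hK.isClosed.isOpen_compl.connectedComponentIn
  have hqV : q ∈ V := mem_connectedComponentIn hq
  have hfr : frontier V ⊆ K := by
    intro z hz
    by_contra hzK
    have hzo : IsOpen (connectedComponentIn Kᶜ z) :=
      hK.isClosed.isOpen_compl.connectedComponentIn
    have hzm : z ∈ connectedComponentIn Kᶜ z := mem_connectedComponentIn hzK
    obtain ⟨w, hw1, hw2⟩ := mem_closure_iff.1 hz.1 _ hzo hzm
    have h1 := connectedComponentIn_eq hw1
    have h2 := connectedComponentIn_eq hw2
    have : z ∈ V := by rw [hV, h2, ← h1]; exact hzm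
    exact hz.2 (by rwa [hVo.interior_eq])
  obtain ⟨L, hL, eL⟩ := H
  obtain ⟨G, hG⟩ := ContinuousMap.exists_restrict_eq (Y := ℂ) hK.isClosed
    ⟨K.domRestrict L, continuousOn_iff_continuous_domRestrict.1 hL⟩
  have hGL : ∀ z ∈ K, G z = L z := fun z hz => by
    exact congrArg (fun f => f ⟨z, hz⟩) hG
  -- Replace `w - q` on the bounded component by a nonvanishing function: the two formulas agree on
  -- the frontier, which lies in `K`, and the zero `q` is removed. Hence `F` has a logarithm on the
  -- whole plane.
  let F : ℂ → ℂ := fun w => if w ∈ V then Complex.exp (G w) else w - q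
  have hF : Continuous F := by
    refine Continuous.if (fun z hz => ?_) (by fun_prop) (by fun_prop)
    have hz' := hfr hz
    rw [hGL z hz', eL z hz']
  have hF0 : ∀ z, F z ≠ 0 := by
    intro z
    by_cases hz : z ∈ V
    · simp only [F, if_pos hz]; exact Complex.exp_ne_zero _
    · simp only [F, if_neg hz]
      exact sub_ne_zero.2 fun h => hz (h ▸ hqV)
  obtain ⟨M, hM, eM⟩ := exists_log_of_ne_zero_plane hF hF0
  obtain ⟨R, hR0, hR⟩ := hb.subset_ball_lt 0 q
  -- On a circle about `q` enclosing the component, `F` is still `w - q`, so `g` would be constant,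
  -- yet it drops by `2πi` over one turn.
  let g : ℝ → ℂ := fun t => M (q + R * Complex.exp (t * Complex.I)) - t * Complex.I
  have hg : ∀ t, Complex.exp (g t) = R := by
    intro t
    have hnV : q + R * Complex.exp (t * Complex.I) ∉ V := fun h => by
      have := hR h
      simp [Complex.norm_exp_ofReal_mul_I, abs_of_pos hR0] at this
    simp only [g, Complex.exp_sub, eM, F, if_neg hnV]
    rw [add_sub_cancel_left, mul_div_cancel_right₀ _ (Complex.exp_ne_zero _)]
  have hgc : Continuous g := by fun_prop
  have := eq_of_exp_eq_const isPreconnected_univ hgc.continuousOn (fun t _ => hg t)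
    (mem_univ 0) (mem_univ (2 * Real.pi))
  simp only [g, Complex.ofReal_zero, zero_mul, Complex.exp_zero, mul_one, sub_zero,
    Complex.ofReal_mul, Complex.ofReal_ofNat, Complex.exp_two_pi_mul_I] at this
  exact Complex.two_pi_I_ne_zero (by linear_combination this)

end Logarithms

/-! ### Sub-sums of a periodic sign sequence: cylinders and their topology. -/

lemma norm_digit_le {e : ℤ} (he : e = -1 ∨ e = 0 ∨ e = 1) : ‖(e : ℂ)‖ ≤ 1 := by
  rcases he with h | h | h <;> simp [h]

lemma norm_digit_mul_pow_le {e : ℤ} (he : e = -1 ∨ e = 0 ∨ e = 1) (z : ℂ) (n : ℕ) :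
    ‖(e : ℂ) * z ^ n‖ ≤ ‖z‖ ^ n := by
  rw [norm_mul, norm_pow]
  exact mul_le_of_le_one_left (by positivity) (norm_digit_le he)

lemma summable_digits {e : ℕ → ℤ} (he : ∀ n, e n = -1 ∨ e n = 0 ∨ e n = 1) {z : ℂ}
    (hz : ‖z‖ < 1) : Summable fun n => (e n : ℂ) * z ^ n :=
  (summable_geometric_of_lt_one (norm_nonneg z) hz).of_norm_bounded
    fun n => norm_digit_mul_pow_le (he n) z n

lemma norm_tsum_digits_le {e : ℕ → ℤ} (he : ∀ n, e n = -1 ∨ e n = 0 ∨ e n = 1) {z : ℂ}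
    (hz : ‖z‖ < 1) : ‖∑' n, (e n : ℂ) * z ^ n‖ ≤ (1 - ‖z‖)⁻¹ :=
  tsum_of_norm_bounded (hasSum_geometric_of_lt_one (norm_nonneg z) hz)
    fun n => norm_digit_mul_pow_le (he n) z n

/-- A point `lam` with a unique normalized series `c` vanishing there, together with a two-sided
periodic sequence of signs `d` none of whose tails is proportional to `c`. -/
structure PeriodicTail where
  lam : ℂ
  c : ℕ → ℤ
  d : ℤ → ℤ
  p : ℕ
  lam_ne : lam ≠ 0
  norm_lt : ‖lam‖ < 1
  p_pos : 0 < p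
  c_zero : c 0 = 1
  c_unit : ∀ n, c n = 1 ∨ c n = -1
  c_sum : ∑' n, (c n : ℂ) * lam ^ n = 0
  uniq : ∀ a : ℕ → ℤ, a 0 = 1 → (∀ n, a n = -1 ∨ a n = 0 ∨ a n = 1) →
    ∑' n, (a n : ℂ) * lam ^ n = 0 → a = c
  d_unit : ∀ k, d k = 1 ∨ d k = -1
  d_per : ∀ k, d (k + p) = d k
  d_tail : ∀ j, ∃ i : ℕ, d (j + i) ≠ d j * c i

namespace PeriodicTail

variable (D : PeriodicTail)

/-- The `i`-th digit of the sub-sum selected by `b` of the tail of `d` at `j`. -/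
def digit (j : ℤ) (b : ℕ → Bool) (i : ℕ) : ℤ := if b i then D.d (j + i) else 0

/-- The sub-sum selected by `b` of the tail of `d` at `j`. -/
def subsum (j : ℤ) (b : ℕ → Bool) : ℂ := ∑' i, (D.digit j b i : ℂ) * D.lam ^ i

/-- The translate by `a` of the set of sub-sums of the tail of `∑ d i lam ^ i` starting at `k`. -/
def cyl (a : ℂ) (k : ℤ) : Set ℂ := range fun b : ℕ → Bool => a + D.lam ^ k * D.subsum k b

/-- The set of sub-sums of the tail of `∑ d i lam ^ i` starting at `k`. -/
def tail (k : ℤ) : Set ℂ := D.cyl 0 k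

/-- The set of sub-sums of the tail at `k` which use the `k`-th term. -/
def piece (k : ℤ) : Set ℂ := D.cyl (D.lam ^ k * D.d k) (k + 1)

lemma norm_pos : 0 < ‖D.lam‖ := norm_pos_iff.2 D.lam_ne

lemma d_mul_self (k : ℤ) : D.d k * D.d k = 1 := by
  rcases D.d_unit k with h | h <;> simp [h]

lemma c_ne (n : ℕ) : D.c n ≠ 0 := by
  rcases D.c_unit n with h | h <;> simp [h]

lemma d_per_mul (k : ℤ) (m : ℤ) : D.d (k + D.p * m) = D.d k := by
  induction m using Int.induction_on with
  | zero => simp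
  | succ i ih => rw [← ih, ← D.d_per (k + D.p * i)]; congr 1; ring
  | pred i ih => rw [← ih, ← D.d_per (k + D.p * (-i - 1))]; congr 1; ring

lemma digit_mem (j : ℤ) (b : ℕ → Bool) (i : ℕ) :
    D.digit j b i = -1 ∨ D.digit j b i = 0 ∨ D.digit j b i = 1 := by
  unfold digit
  split_ifs
  · rcases D.d_unit (j + i) with h | h <;> simp [h]
  · simp

lemma subsum_shift (j : ℤ) (b : ℕ → Bool) :
    D.subsum j b = (D.digit j b 0 : ℂ) + D.lam * D.subsum (j + 1) fun i => b (i + 1) := by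
  unfold subsum
  rw [(summable_digits (D.digit_mem j b) D.norm_lt).tsum_eq_zero_add, ← tsum_mul_left]
  simp only [pow_zero, mul_one]
  congr 1
  refine tsum_congr fun i => ?_
  have : D.digit j b (i + 1) = D.digit (j + 1) (fun i => b (i + 1)) i := by
    simp only [digit]
    congr 2
    push_cast; ring
  rw [this]; ring

lemma subsum_add_period (j m : ℤ) (b : ℕ → Bool) :
    D.subsum (j + D.p * m) b = D.subsum j b := by
  unfold subsum digit
  have : ∀ i : ℕ, D.d (j + D.p * m + i) = D.d (j + i) := fun i => by
    rw [← D.d_per_mul (j + i) m]; congr 1; ring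
  simp only [this]

lemma norm_subsum_le (j : ℤ) (b : ℕ → Bool) : ‖D.subsum j b‖ ≤ (1 - ‖D.lam‖)⁻¹ :=
  norm_tsum_digits_le (D.digit_mem j b) D.norm_lt

lemma continuous_subsum (j : ℤ) : Continuous (D.subsum j) := by
  refine continuous_tsum (u := fun i => ‖D.lam‖ ^ i) (fun i => ?_)
    (summable_geometric_of_lt_one (norm_nonneg _) D.norm_lt)
    fun i b => norm_digit_mul_pow_le (D.digit_mem j b i) _ _
  have : Continuous fun x : Bool => ((if x then D.d (j + i) else 0 : ℤ) : ℂ) :=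
    continuous_of_discreteTopology
  exact (this.comp (continuous_apply i)).mul continuous_const

lemma isCompact_cyl (a : ℂ) (k : ℤ) : IsCompact (D.cyl a k) :=
  isCompact_range (continuous_const.add (continuous_const.mul (D.continuous_subsum k)))

lemma isClosed_cyl (a : ℂ) (k : ℤ) : IsClosed (D.cyl a k) := (D.isCompact_cyl a k).isClosed

lemma isCompact_piece (k : ℤ) : IsCompact (D.piece k) := D.isCompact_cyl _ _

lemma cyl_eq_union (a : ℂ) (k : ℤ) :
    D.cyl a k = D.cyl (a + D.lam ^ k * D.d k) (k + 1) ∪ D.cyl a (k + 1) := by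
  have hz : D.lam ^ (k + 1) = D.lam ^ k * D.lam := zpow_add_one₀ D.lam_ne k
  apply Subset.antisymm
  · rintro _ ⟨b, rfl⟩
    simp only
    rw [D.subsum_shift]
    by_cases hb : b 0
    · left
      refine ⟨fun i => b (i + 1), ?_⟩
      simp only [digit, hb, if_true, hz]
      push_cast
      rw [add_zero]; ring
    · right
      refine ⟨fun i => b (i + 1), ?_⟩
      simp only [digit, hb, hz]
      simp
      ring
  · rintro _ (⟨b, rfl⟩ | ⟨b, rfl⟩)
    · refine ⟨fun i => Nat.casesOn i true b, ?_⟩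
      simp only [hz]
      rw [D.subsum_shift]
      simp [digit]
      ring
    · refine ⟨fun i => Nat.casesOn i false b, ?_⟩
      simp only [hz]
      rw [D.subsum_shift]
      simp [digit]
      ring

lemma tail_eq_union (k : ℤ) : D.tail k = D.piece k ∪ D.tail (k + 1) := by
  unfold tail piece
  rw [D.cyl_eq_union 0 k, zero_add]

lemma mem_piece_iff {k : ℤ} {z : ℂ} :
    z ∈ D.piece k ↔ ∃ b : ℕ → Bool, b 0 = true ∧ z = D.lam ^ k * D.subsum k b := by
  have hz : D.lam ^ (k + 1) = D.lam ^ k * D.lam := zpow_add_one₀ D.lam_ne k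
  constructor
  · rintro ⟨b, rfl⟩
    refine ⟨fun i => Nat.casesOn i true b, rfl, ?_⟩
    simp only [hz]
    rw [D.subsum_shift k]
    simp [digit]
    ring
  · rintro ⟨b, hb, rfl⟩
    refine ⟨fun i => b (i + 1), ?_⟩
    simp only [hz]
    rw [D.subsum_shift k]
    simp [digit, hb]
    ring

lemma subsum_drop (j : ℤ) (n : ℕ) (b : ℕ → Bool) (hb : ∀ i < n, b i = false) :
    D.lam ^ j * D.subsum j b = D.lam ^ (j + n) * D.subsum (j + n) fun i => b (i + n) := by
  induction n with
  | zero => simp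
  | succ n ih =>
    rw [ih fun i hi => hb i (by omega), D.subsum_shift (j + n)]
    have h1 : D.digit (j + n) (fun i => b (i + n)) 0 = 0 := by
      simp [digit, hb n (by omega)]
    have h2 : D.lam ^ (j + ((n + 1 : ℕ) : ℤ)) = D.lam ^ (j + n) * D.lam := by
      rw [← zpow_add_one₀ D.lam_ne]; congr 1; push_cast; ring
    have h3 : j + ((n + 1 : ℕ) : ℤ) = j + n + 1 := by push_cast; ring
    rw [h1, h2, h3]
    have h4 : (fun i => b (i + 1 + n)) = fun i => b (i + (n + 1)) := by
      funext i; congr 1; ring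
    rw [h4]
    push_cast; ring

/-- Prepend `n` zeros to a binary sequence. -/
def pad (n : ℕ) (b : ℕ → Bool) : ℕ → Bool := fun i => if i < n then false else b (i - n)

lemma subsum_pad (j : ℤ) (n : ℕ) (b : ℕ → Bool) :
    D.lam ^ j * D.subsum j (pad n b) = D.lam ^ (j + n) * D.subsum (j + n) b := by
  rw [D.subsum_drop j n (pad n b) fun i hi => if_pos hi]
  congr 2
  funext i
  simp [pad]

lemma mem_piece_iff_of_le {j k : ℤ} (h : j ≤ k) {z : ℂ} :
    z ∈ D.piece k ↔ ∃ b : ℕ → Bool, (∀ i < (k - j).toNat, b i = false) ∧ b (k - j).toNat = true ∧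
      z = D.lam ^ j * D.subsum j b := by
  obtain ⟨n, rfl⟩ : ∃ n : ℕ, k = j + n := ⟨(k - j).toNat, by omega⟩
  have hn : (j + n - j).toNat = n := by omega
  rw [hn, mem_piece_iff]
  constructor
  · rintro ⟨b, hb, rfl⟩
    refine ⟨pad n b, fun i hi => if_pos hi, by simpa [pad] using hb, (D.subsum_pad j n b).symm⟩
  · rintro ⟨b, hb, hb', rfl⟩
    exact ⟨fun i => b (i + n), by simpa using hb', D.subsum_drop j n b hb⟩

/-- Multiplied by the sign `D.d j`, the difference of the two sums is a normalized series vanishing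
at `lam`, hence has coefficients `c`. Since no `c i` is zero, exactly one of `b i`, `b' i` is true,
and the sign decides which. -/
lemma eq_c_of_subsum_eq {j : ℤ} {b b' : ℕ → Bool} (h : D.subsum j b = D.subsum j b')
    (hb : b 0 = true) (hb' : b' 0 = false) (i : ℕ) :
    b' i = !b i ∧ (b i = true ↔ D.d (j + i) = D.d j * D.c i) := by
  have h0 : (fun i => D.d j * (D.digit j b i - D.digit j b' i)) = D.c := by
    refine D.uniq _ ?_ ?_ ?_
    · simp [digit, hb, hb', D.d_mul_self]
    · intro n
      simp only [digit]
      rcases D.d_unit j with h1 | h1 <;> rcases D.d_unit (j + n) with h2 | h2 <;>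
        cases b n <;> cases b' n <;> simp [h1, h2]
    · have h1 := (summable_digits (D.digit_mem j b) D.norm_lt).tsum_sub
        (summable_digits (D.digit_mem j b') D.norm_lt)
      change _ = D.subsum j b - D.subsum j b' at h1
      rw [h, sub_self] at h1
      rw [← mul_zero (D.d j : ℂ), ← h1, ← tsum_mul_left]
      refine tsum_congr fun n => ?_
      push_cast; ring
  have h1 := congrFun h0 i
  have h2 := D.c_ne i
  simp only [digit] at h1
  rcases D.d_unit j with h3 | h3 <;> rcases D.d_unit (j + i) with h4 | h4 <;>
    rcases D.c_unit i with h5 | h5 <;>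
    cases hb1 : b i <;> cases hb2 : b' i <;> simp [h3, h4, h5, hb1, hb2] at h1 ⊢

/-- The selection of terms representing the point shared by the two halves of `D.tail j`. -/
def jointSel (j : ℤ) : ℕ → Bool := fun i => decide (D.d (j + i) = D.d j * D.c i)

/-- The point shared by the two halves of `D.tail j`. -/
def joint (j : ℤ) : ℂ := D.lam ^ j * D.subsum j (D.jointSel j)

lemma jointSel_zero (j : ℤ) : D.jointSel j 0 = true := by simp [jointSel, D.c_zero]

/-- The difference of the two sums is `D.d j` times the value of `c` at `lam`, which is 0. -/
lemma subsum_not_jointSel (j : ℤ) :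
    D.subsum j (fun i => !D.jointSel j i) = D.subsum j (D.jointSel j) := by
  rw [eq_comm, ← sub_eq_zero]
  unfold subsum
  rw [← (summable_digits (D.digit_mem j _) D.norm_lt).tsum_sub
        (summable_digits (D.digit_mem j _) D.norm_lt), ← mul_zero (D.d j : ℂ), ← D.c_sum,
        ← tsum_mul_left]
  refine tsum_congr fun n => ?_
  have : D.digit j (D.jointSel j) n - D.digit j (fun i => !D.jointSel j i) n = D.d j * D.c n := by
    simp only [digit, jointSel]
    rcases D.d_unit j with h3 | h3 <;> rcases D.d_unit (j + n) with h4 | h4 <;>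
      rcases D.c_unit n with h5 | h5 <;> simp [h3, h4, h5]
  rw [← sub_mul, ← Int.cast_sub, this]
  push_cast; ring

lemma cyl_inter (a : ℂ) (k : ℤ) :
    D.cyl (a + D.lam ^ k * D.d k) (k + 1) ∩ D.cyl a (k + 1) = {a + D.joint k} := by
  have hz : D.lam ^ (k + 1) = D.lam ^ k * D.lam := zpow_add_one₀ D.lam_ne k
  have e1 : ∀ b : ℕ → Bool, a + D.lam ^ k * D.d k + D.lam ^ (k + 1) * D.subsum (k + 1) b =
      a + D.lam ^ k * D.subsum k (fun i => Nat.casesOn i true b) := fun b => by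
    rw [D.subsum_shift k, hz]; simp [digit]; ring
  have e2 : ∀ b : ℕ → Bool, a + D.lam ^ (k + 1) * D.subsum (k + 1) b =
      a + D.lam ^ k * D.subsum k (fun i => Nat.casesOn i false b) := fun b => by
    rw [D.subsum_shift k, hz]; simp [digit]; ring
  apply Subset.antisymm
  · rintro _ ⟨⟨b, rfl⟩, ⟨b', h⟩⟩
    simp only [e1, e2] at h ⊢
    have h1 := mul_left_cancel₀ (zpow_ne_zero k D.lam_ne) (add_left_cancel h)
    have h2 := D.eq_c_of_subsum_eq h1.symm rfl rfl
    simp only [mem_singleton_iff, joint]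
    congr 3
    funext i
    have := (h2 i).2
    rw [Bool.eq_iff_iff, this, jointSel, decide_eq_true_iff]
  · rintro _ rfl
    constructor
    · refine ⟨fun i => D.jointSel k (i + 1), ?_⟩
      simp only [e1, joint]
      congr 3
      funext i
      cases i with
      | zero => exact (D.jointSel_zero k).symm
      | succ i => rfl
    · refine ⟨fun i => !D.jointSel k (i + 1), ?_⟩
      simp only [e2, joint]
      rw [← D.subsum_not_jointSel]
      congr 3
      funext i
      cases i with
      | zero => simp [D.jointSel_zero k]
      | succ i => rfl

lemma cyl_subset_closedBall (a : ℂ) (k : ℤ) :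
    D.cyl a k ⊆ Metric.closedBall a (‖D.lam‖ ^ k * (1 - ‖D.lam‖)⁻¹) := by
  rintro _ ⟨b, rfl⟩
  rw [mem_closedBall_iff_norm, add_sub_cancel_left, norm_mul, norm_zpow]
  exact mul_le_mul_of_nonneg_left (D.norm_subsum_le k b) (zpow_nonneg (norm_nonneg _) _)

/-- A property which holds for small sets and passes to unions of closed sets meeting in one point
holds for `D.cyl a k`. -/
theorem cyl_induction (a : ℂ) (k : ℤ) (P : Set ℂ → Prop)
    (hjoin : ∀ K₁ K₂ x, IsClosed K₁ → IsClosed K₂ → K₁ ∩ K₂ = {x} → K₁ ∪ K₂ ⊆ D.cyl a k →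
      P K₁ → P K₂ → P (K₁ ∪ K₂))
    (hsmall : ∃ δ > 0, ∀ Q ⊆ D.cyl a k, (∀ x ∈ Q, ∀ y ∈ Q, dist x y < δ) → P Q) :
    P (D.cyl a k) := by
  obtain ⟨δ, hδ, hsmall⟩ := hsmall
  -- Twice the radius of a ball containing a cylinder `n` levels down; once it is below `δ`, those
  -- cylinders are small and are joined back up to level `k`.
  have h1 : Tendsto (fun n : ℕ => 2 * (‖D.lam‖ ^ k * ‖D.lam‖ ^ n * (1 - ‖D.lam‖)⁻¹)) atTop (𝓝 0) := by
    have := tendsto_pow_atTop_nhds_zero_of_lt_one (norm_nonneg _) D.norm_lt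
    simpa using ((this.const_mul (‖D.lam‖ ^ k)).mul_const (1 - ‖D.lam‖)⁻¹).const_mul 2
  obtain ⟨n, hn⟩ := (h1.eventually (gt_mem_nhds hδ)).exists
  have key : ∀ m : ℕ, ∀ (a' : ℂ) (k' : ℤ), D.cyl a' k' ⊆ D.cyl a k → k' + m = k + n →
      P (D.cyl a' k') := by
    intro m
    induction m with
    | zero =>
      intro a' k' hs hk
      refine hsmall _ hs fun x hx y hy => lt_of_le_of_lt ?_ hn
      have hx := D.cyl_subset_closedBall _ _ hx
      have hy := D.cyl_subset_closedBall _ _ hy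
      have hk' : k' = k + n := by simpa using hk
      have e : ‖D.lam‖ ^ k' = ‖D.lam‖ ^ k * ‖D.lam‖ ^ n := by
        rw [hk', zpow_add₀ D.norm_pos.ne', zpow_natCast]
      rw [e] at hx hy
      have := dist_triangle_right x y a'
      rw [Metric.mem_closedBall] at hx hy
      linarith
    | succ m ih =>
      intro a' k' hs hk
      rw [D.cyl_eq_union] at hs ⊢
      exact hjoin _ _ _ (D.isClosed_cyl _ _) (D.isClosed_cyl _ _) (D.cyl_inter _ _) hs
        (ih _ _ (subset_union_left.trans hs) (by push_cast at hk; linarith))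
        (ih _ _ (subset_union_right.trans hs) (by push_cast at hk; linarith))
  exact key n a k subset_rfl rfl

/-- On a small set `h` varies by less than its minimum modulus on the cylinder, so its values stay
in a disc missing 0. -/
lemma logAcyclic_cyl (a : ℂ) (k : ℤ) : LogAcyclic (D.cyl a k) := by
  intro h hc h0
  refine D.cyl_induction a k (HasLogOn h) ?_ ?_
  · intro K₁ K₂ x h1 h2 hx _ H1 H2
    exact H1.union h1 h2 H2 hx.subset
  · have hK := D.isCompact_cyl a k
    have hne : (D.cyl a k).Nonempty := range_nonempty _
    obtain ⟨x₀, hx₀, hmin⟩ := hK.exists_isMinOn hne hc.norm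
    have huc := hK.uniformContinuousOn_of_continuous hc
    obtain ⟨δ, hδ, hu⟩ := Metric.uniformContinuousOn_iff.1 huc ‖h x₀‖ (norm_pos_iff.2 (h0 _ hx₀))
    refine ⟨δ, hδ, fun Q hQ hd => ?_⟩
    rcases Q.eq_empty_or_nonempty with rfl | ⟨y, hy⟩
    · exact ⟨fun _ => 0, continuousOn_empty _, fun z hz => hz.elim⟩
    · refine hasLogOn_of_norm_sub_lt (hc.mono hQ) (v := h y) fun z hz => ?_
      rw [← dist_eq_norm]
      exact (hu z (hQ hz) y (hQ hy) (hd z hz y hy)).trans_le (hmin (hQ hy))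

lemma isPreconnected_cyl (a : ℂ) (k : ℤ) : IsPreconnected (D.cyl a k) := by
  rw [isPreconnected_iff_subset_of_disjoint]
  intro u v hu hv huv hd
  refine D.cyl_induction a k (fun Q => Q ⊆ u ∨ Q ⊆ v) ?_ ?_
  · intro K₁ K₂ x _ _ hx hs H1 H2
    have hx1 : x ∈ K₁ ∩ K₂ := hx ▸ rfl
    have hno : ¬ (x ∈ u ∧ x ∈ v) := fun h => by
      have : x ∈ D.cyl a k ∩ (u ∩ v) := ⟨hs (Or.inl hx1.1), h⟩
      rw [hd] at this
      exact this
    rcases H1 with H1 | H1 <;> rcases H2 with H2 | H2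
    · exact Or.inl (union_subset H1 H2)
    · exact (hno ⟨H1 hx1.1, H2 hx1.2⟩).elim
    · exact (hno ⟨H2 hx1.2, H1 hx1.1⟩).elim
    · exact Or.inr (union_subset H1 H2)
  · obtain ⟨δ, hδ, hL⟩ := lebesgue_number_lemma_of_metric (c := fun b : Bool => cond b u v)
      (D.isCompact_cyl a k) (by rintro (_ | _) <;> assumption)
      (by rw [← union_eq_iUnion]; exact huv)
    refine ⟨δ, hδ, fun Q hQ hdist => ?_⟩
    rcases Q.eq_empty_or_nonempty with rfl | ⟨y, hy⟩
    · exact Or.inl (empty_subset _)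
    · obtain ⟨i, hi⟩ := hL y (hQ hy)
      have : Q ⊆ cond i u v := fun z hz => hi (hdist z hz y hy)
      cases i
      · exact Or.inr this
      · exact Or.inl this

lemma isPreconnected_ball_diff_singleton (x y : ℂ) (r : ℝ) :
    IsPreconnected (Metric.ball x r \ {y}) := by
  rcases le_or_gt r 0 with hr | hr
  · simp [Metric.ball_eq_empty.2 hr, isPreconnected_empty]
  by_cases hy : y ∈ Metric.ball x r
  · let e := OpenPartialHomeomorph.univBall x r
    have ht : e.target = Metric.ball x r := OpenPartialHomeomorph.univBall_target x hr
    have hs : e.source = univ := OpenPartialHomeomorph.univBall_source x r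
    have h1 : Metric.ball x r \ {y} = e '' {e.symm y}ᶜ := by
      ext z
      constructor
      · rintro ⟨hz, hzy⟩
        rw [← ht] at hz hy
        refine ⟨e.symm z, fun h => hzy ?_, e.right_inv hz⟩
        have h2 : e.symm z = e.symm y := h
        rw [mem_singleton_iff, ← e.right_inv hz, h2, e.right_inv hy]
      · rintro ⟨w, hw, rfl⟩
        have hws : w ∈ e.source := hs ▸ mem_univ w
        refine ⟨ht ▸ e.map_source hws, fun h => hw ?_⟩
        rw [mem_singleton_iff] at h ⊢
        rw [← h, e.left_inv hws]
    rw [h1]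
    exact (isConnected_compl_singleton_of_one_lt_rank (by simp) _).isPreconnected.image _
      (OpenPartialHomeomorph.continuous_univBall x r).continuousOn
  · rw [sdiff_singleton_eq_self hy]
    exact (convex_ball x r).isPreconnected

/-- If a ball is covered by two closed sets with one common point, the punctured ball is connected
and so lies in one of them, and then the full ball does by closedness. Descending, the ball would
fit into arbitrarily small cylinders. -/
lemma interior_cyl (a : ℂ) (k : ℤ) : interior (D.cyl a k) = ∅ := by
  rw [← not_nonempty_iff_eq_empty]
  rintro ⟨x, hx⟩
  obtain ⟨r, hr, hball⟩ := Metric.isOpen_iff.1 isOpen_interior x hx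
  have hsub := hball.trans interior_subset
  refine D.cyl_induction a k (fun Q => ¬ Metric.ball x r ⊆ Q) ?_ ?_ hsub
  · intro K₁ K₂ y h1 h2 hy _ H1 H2 H
    have hc := isPreconnected_ball_diff_singleton x y r
    rw [isPreconnected_iff_subset_of_disjoint_closed] at hc
    have hcl : ∀ K, IsClosed K → Metric.ball x r \ {y} ⊆ K → Metric.ball x r ⊆ K := by
      intro K hK hs
      have hd : Dense ({y}ᶜ : Set ℂ) := dense_compl_singleton y
      have h3 := hd.open_subset_closure_inter (Metric.isOpen_ball (x := x) (ε := r))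
      exact h3.trans (hK.closure_subset_iff.2 (by simpa [sdiff_eq] using hs))
    rcases hc K₁ K₂ h1 h2 (sdiff_subset.trans H) (by
      rw [hy]; ext z; simp) with h | h
    · exact H1 (hcl _ h1 h)
    · exact H2 (hcl _ h2 h)
  · refine ⟨r / 2, by positivity, fun Q _ hd hs => ?_⟩
    have h1 := hd (x + (r / 2 : ℝ)) (hs (by
      rw [mem_ball_iff_norm, add_sub_cancel_left, Complex.norm_real, Real.norm_eq_abs,
        abs_of_pos (by positivity)]; linarith)) x (hs (Metric.mem_ball_self hr))
    rw [dist_eq_norm, add_sub_cancel_left, Complex.norm_real, Real.norm_eq_abs,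
        abs_of_pos (by positivity)] at h1
    exact lt_irrefl _ h1

end PeriodicTail

/-! ### The self-similar locus and the intersections of its pieces. -/

namespace PeriodicTail

variable (D : PeriodicTail)

/-- 0 is also the empty sub-sum. A second representation using the `k`-th term would select every
term, making the tail of `d` at `k` proportional to `c`. -/
lemma zero_notMem_piece (k : ℤ) : (0 : ℂ) ∉ D.piece k := by
  intro h
  obtain ⟨b, hb, h0⟩ := D.mem_piece_iff.1 h
  have h1 : D.subsum k b = 0 :=
    (mul_eq_zero.1 h0.symm).resolve_left (zpow_ne_zero k D.lam_ne)
  have h2 : D.subsum k b = D.subsum k fun _ => false := by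
    rw [h1]; simp [subsum, digit]
  obtain ⟨i, hi⟩ := D.d_tail k
  have h3 := D.eq_c_of_subsum_eq h2 hb rfl i
  have h4 : b i = true := by simpa using h3.1
  exact hi (h3.2.1 h4)

lemma ne_zero_of_mem_piece {k : ℤ} {z : ℂ} (h : z ∈ D.piece k) : z ≠ 0 :=
  fun h0 => D.zero_notMem_piece k (h0 ▸ h)

lemma mul_mem_piece_iff {k : ℤ} (m : ℤ) {z : ℂ} :
    D.lam ^ (D.p * m) * z ∈ D.piece (k + D.p * m) ↔ z ∈ D.piece k := by
  rw [mem_piece_iff, mem_piece_iff]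
  refine exists_congr fun b => and_congr_right fun _ => ?_
  rw [D.subsum_add_period, zpow_add₀ D.lam_ne, mul_comm (D.lam ^ k), mul_assoc]
  exact ⟨fun h => mul_left_cancel₀ (zpow_ne_zero _ D.lam_ne) h, fun h => by rw [h]⟩

lemma norm_le_of_mem_piece {k : ℤ} {z : ℂ} (h : z ∈ D.piece k) :
    ‖z‖ ≤ ‖D.lam‖ ^ k * (1 - ‖D.lam‖)⁻¹ := by
  obtain ⟨b, -, rfl⟩ := D.mem_piece_iff.1 h
  rw [norm_mul, norm_zpow]
  exact mul_le_mul_of_nonneg_left (D.norm_subsum_le k b) (zpow_nonneg (norm_nonneg _) _)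

lemma exists_reduce (k : ℤ) : ∃ r < D.p, ∃ m : ℤ, k = r + D.p * m := by
  have hp : (0 : ℤ) < D.p := by exact_mod_cast D.p_pos
  refine ⟨(k % D.p).toNat, ?_, k / D.p, ?_⟩
  · have := Int.emod_lt_of_pos k hp
    have := Int.emod_nonneg k hp.ne'
    omega
  · rw [Int.toNat_of_nonneg (Int.emod_nonneg k hp.ne')]
    exact (Int.emod_add_mul_ediv k D.p).symm

/-- Up to scaling by powers of `lam ^ p` there are only `p` pieces, each compact and missing 0. -/
lemma exists_le_norm_piece : ∃ δ > 0, ∀ k : ℤ, ∀ z ∈ D.piece k, δ * ‖D.lam‖ ^ k ≤ ‖z‖ := by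
  have h1 : ∀ r : ℕ, ∃ δ > 0, ∀ z ∈ D.piece r, δ * ‖D.lam‖ ^ (r : ℤ) ≤ ‖z‖ := by
    intro r
    obtain ⟨x, hx, hmin⟩ := (D.isCompact_piece r).exists_isMinOn (range_nonempty _)
      continuous_norm.continuousOn
    have hq := zpow_pos D.norm_pos (r : ℤ)
    refine ⟨‖x‖ / ‖D.lam‖ ^ (r : ℤ), div_pos (norm_pos_iff.2 (D.ne_zero_of_mem_piece hx)) hq,
      fun z hz => ?_⟩
    rw [div_mul_cancel₀ _ hq.ne']
    exact hmin hz
  choose δ hδ hle using h1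
  have hne : (Finset.range D.p).Nonempty := Finset.nonempty_range_iff.2 D.p_pos.ne'
  obtain ⟨r₀, hr₀, hmin⟩ := (Finset.range D.p).exists_min_image δ hne
  refine ⟨δ r₀, hδ r₀, fun k z hz => ?_⟩
  obtain ⟨r, hr, m, rfl⟩ := D.exists_reduce k
  have h2 : D.lam ^ (D.p * (-m)) * z ∈ D.piece r := by
    have := (D.mul_mem_piece_iff (k := r + D.p * m) (-m) (z := z)).2 hz
    rwa [show (r : ℤ) + D.p * m + D.p * (-m) = r by ring] at this
  have h3 := hle r _ h2
  rw [norm_mul, norm_zpow] at h3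
  have h4 := zpow_pos D.norm_pos (D.p * m)
  have h5 : ‖D.lam‖ ^ (D.p * m) * ‖D.lam‖ ^ (D.p * (-m)) = 1 := by
    rw [← zpow_add₀ D.norm_pos.ne', show (D.p : ℤ) * m + D.p * (-m) = 0 by ring, zpow_zero]
  calc δ r₀ * ‖D.lam‖ ^ ((r : ℤ) + D.p * m)
      ≤ δ r * ‖D.lam‖ ^ ((r : ℤ) + D.p * m) :=
        mul_le_mul_of_nonneg_right (hmin r (Finset.mem_range.2 hr)) (zpow_nonneg (norm_nonneg _) _)
    _ = ‖D.lam‖ ^ (D.p * m) * (δ r * ‖D.lam‖ ^ (r : ℤ)) := by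
        rw [zpow_add₀ D.norm_pos.ne']; ring
    _ ≤ ‖D.lam‖ ^ (D.p * m) * (‖D.lam‖ ^ (D.p * (-m)) * ‖z‖) :=
        mul_le_mul_of_nonneg_left h3 h4.le
    _ = ‖z‖ := by rw [← mul_assoc, h5, one_mul]

/-- All sub-sums of two-sided sums `∑ d i lam ^ i` with finitely many negative exponents. -/
def locus : Set ℂ := ⋃ k, D.tail k

lemma zero_mem_tail (k : ℤ) : (0 : ℂ) ∈ D.tail k :=
  ⟨fun _ => false, by simp [subsum, digit]⟩

lemma tail_subset_tail {j k : ℤ} (h : j ≤ k) : D.tail k ⊆ D.tail j := by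
  obtain ⟨n, rfl⟩ : ∃ n : ℕ, k = j + n := ⟨(k - j).toNat, by omega⟩
  rintro _ ⟨b, rfl⟩
  exact ⟨pad n b, by simp only [D.subsum_pad]⟩

lemma piece_subset_tail (k : ℤ) : D.piece k ⊆ D.tail k :=
  D.tail_eq_union k ▸ subset_union_left

lemma mem_tail_iff {j : ℤ} {z : ℂ} : z ∈ D.tail j ↔ z = 0 ∨ ∃ k ≥ j, z ∈ D.piece k := by
  constructor
  · rintro ⟨b, rfl⟩
    simp only [zero_add]
    by_cases hb : ∃ i, b i = true
    · classical
      right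
      refine ⟨j + (Nat.find hb : ℕ), by simp, (D.mem_piece_iff_of_le (by simp)).2 ⟨b, ?_, ?_, rfl⟩⟩
      · intro i hi
        have := Nat.find_min hb (m := i) (by omega)
        simpa using this
      · rw [show (j + (Nat.find hb : ℕ) - j).toNat = Nat.find hb by omega]
        exact Nat.find_spec hb
    · left
      have : b = fun _ => false := by
        funext i
        simpa using fun h => hb ⟨i, h⟩
      rw [this]
      simp [subsum, digit]
  · rintro (rfl | ⟨k, hk, h⟩)
    · exact D.zero_mem_tail j
    · exact D.tail_subset_tail hk (D.piece_subset_tail k h)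

lemma mem_locus_iff {z : ℂ} : z ∈ D.locus ↔ z = 0 ∨ ∃ k, z ∈ D.piece k := by
  simp only [locus, mem_iUnion, D.mem_tail_iff]
  constructor
  · rintro ⟨j, h | ⟨k, -, h⟩⟩
    · exact Or.inl h
    · exact Or.inr ⟨k, h⟩
  · rintro (h | ⟨k, h⟩)
    · exact ⟨0, Or.inl h⟩
    · exact ⟨k, Or.inr ⟨k, le_rfl, h⟩⟩

lemma mul_mem_locus_iff (m : ℤ) {z : ℂ} : D.lam ^ (D.p * m) * z ∈ D.locus ↔ z ∈ D.locus := by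
  rw [mem_locus_iff, mem_locus_iff]
  refine or_congr ?_ ?_
  · simp [D.lam_ne, zpow_ne_zero]
  · constructor
    · rintro ⟨k, hk⟩
      refine ⟨k - D.p * m, (D.mul_mem_piece_iff m).1 ?_⟩
      rwa [sub_add_cancel]
    · rintro ⟨k, hk⟩
      exact ⟨_, (D.mul_mem_piece_iff m).2 hk⟩

lemma tendsto_zpow_atBot : Tendsto (fun k : ℤ => ‖D.lam‖ ^ k) atBot atTop := by
  refine tendsto_atBot_atTop_of_antitone
    (fun a b h => zpow_le_zpow_right_of_le_one₀ D.norm_pos D.norm_lt.le h) fun b => ?_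
  obtain ⟨n, hn⟩ := pow_unbounded_of_one_lt b ((one_lt_inv₀ D.norm_pos).2 D.norm_lt)
  exact ⟨-n, by rw [zpow_neg, zpow_natCast, ← inv_pow]; exact hn.le⟩

lemma exists_tail_of_norm_lt (r : ℝ) : ∃ k, ∀ z ∈ D.locus, ‖z‖ < r → z ∈ D.tail k := by
  obtain ⟨δ, hδ, hle⟩ := D.exists_le_norm_piece
  obtain ⟨k, hk⟩ := eventually_atBot.1
    ((D.tendsto_zpow_atBot.const_mul_atTop hδ).eventually_ge_atTop r)
  refine ⟨k, fun z hz hr => D.mem_tail_iff.2 ?_⟩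
  rcases D.mem_locus_iff.1 hz with h | ⟨j, hj⟩
  · exact Or.inl h
  · refine Or.inr ⟨j, ?_, hj⟩
    by_contra hjk
    have := hk j (by omega)
    have := hle j z hj
    linarith

/-- Pieces of very negative index are far from 0, so in a bounded region the locus coincides with a
single compact tail. -/
lemma isClosed_locus : IsClosed D.locus := by
  rw [← isOpen_compl_iff, Metric.isOpen_iff]
  intro z hz
  obtain ⟨k, hk⟩ := D.exists_tail_of_norm_lt (‖z‖ + 1)
  have hzk : z ∉ D.tail k := fun h => hz (mem_iUnion.2 ⟨k, h⟩)
  obtain ⟨r, hr, hball⟩ := Metric.isOpen_iff.1 (D.isClosed_cyl 0 k).isOpen_compl z hzk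
  refine ⟨min r 1, lt_min hr one_pos, fun w hw hwl => ?_⟩
  rw [Metric.mem_ball, lt_min_iff] at hw
  refine hball (Metric.mem_ball.2 hw.1) (hk w hwl ?_)
  have := norm_le_norm_add_norm_sub z w
  rw [dist_eq_norm, norm_sub_rev] at hw
  linarith [hw.2]

lemma exists_notMem_locus : ∃ x, x ∉ D.locus := by
  by_contra! h
  obtain ⟨k, hk⟩ := nonempty_interior_of_iUnion_of_closed (fun k => D.isClosed_cyl 0 k)
    (eq_univ_of_forall h)
  rw [D.interior_cyl] at hk
  exact hk.ne_empty rfl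

/-- The index of the piece which shares the point `D.joint j` with `D.piece j`. -/
def nxt (j : ℤ) : ℤ := by
  classical exact j + Nat.find (D.d_tail j)

lemma lt_nxt (j : ℤ) : j < D.nxt j := by
  classical
  have : Nat.find (D.d_tail j) ≠ 0 := fun h => by
    have := Nat.find_spec (D.d_tail j)
    rw [h] at this
    simp [D.c_zero] at this
  simp only [nxt]
  omega

lemma nxt_add (j m : ℤ) : D.nxt (j + D.p * m) = D.nxt j + D.p * m := by
  classical
  have : Nat.find (D.d_tail (j + D.p * m)) = Nat.find (D.d_tail j) := by
    congr 1
    funext i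
    rw [D.d_per_mul j m, show j + D.p * m + i = (j + i) + D.p * m by ring, D.d_per_mul (j + i) m]
  simp only [nxt]
  omega

lemma joint_mem_piece (j : ℤ) : D.joint j ∈ D.piece j :=
  D.mem_piece_iff.2 ⟨_, D.jointSel_zero j, rfl⟩

lemma joint_mem_piece_nxt (j : ℤ) : D.joint j ∈ D.piece (D.nxt j) := by
  classical
  refine (D.mem_piece_iff_of_le (D.lt_nxt j).le).2 ⟨fun i => !D.jointSel j i, ?_, ?_, ?_⟩
  · intro i hi
    have := Nat.find_min (D.d_tail j) (m := i) (by simp only [nxt] at hi; omega)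
    simpa [jointSel] using this
  · have : (D.nxt j - j).toNat = Nat.find (D.d_tail j) := by simp only [nxt]; omega
    rw [this]
    simpa [jointSel] using Nat.find_spec (D.d_tail j)
  · rw [D.subsum_not_jointSel]; rfl

/-- A common point has a representation using the `j`-th term and one starting at `k`. They are
complementary selections determined by `c`, so `k - j` is the first place where the tail of `d`
departs from `D.d j * c`. -/
lemma piece_inter {j k : ℤ} (hjk : j < k) {z : ℂ} (hj : z ∈ D.piece j) (hk : z ∈ D.piece k) :
    k = D.nxt j ∧ z = D.joint j := by
  classical
  obtain ⟨b, hb, rfl⟩ := D.mem_piece_iff.1 hj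
  obtain ⟨b', hb'1, hb'2, h⟩ := (D.mem_piece_iff_of_le hjk.le).1 hk
  have h1 := mul_left_cancel₀ (zpow_ne_zero j D.lam_ne) h
  have h2 := D.eq_c_of_subsum_eq h1 hb (hb'1 0 (by omega))
  have hbj : b = D.jointSel j := by
    funext i
    rw [Bool.eq_iff_iff, (h2 i).2, jointSel, decide_eq_true_iff]
  constructor
  · have h3 : Nat.find (D.d_tail j) = (k - j).toNat := by
      rw [Nat.find_eq_iff]
      constructor
      · intro h4
        have h5 := h2 (k - j).toNat
        rw [hb'2, h5.2.2 h4] at h5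
        simpa using h5.1
      · intro i hi h4
        have h5 := h2 i
        rw [hb'1 i hi] at h5
        exact h4 (h5.2.1 (by simpa using h5.1))
    simp only [nxt, h3]
    omega
  · rw [hbj]; rfl

lemma logAcyclic_piece (k : ℤ) : LogAcyclic (D.piece k) := D.logAcyclic_cyl _ _

lemma isPreconnected_piece (k : ℤ) : IsPreconnected (D.piece k) := D.isPreconnected_cyl _ _

/-- The union of finitely many pieces. -/
def pieces (I : Finset ℤ) : Set ℂ := ⋃ k ∈ I, D.piece k

lemma mem_pieces {I : Finset ℤ} {z : ℂ} : z ∈ D.pieces I ↔ ∃ k ∈ I, z ∈ D.piece k := by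
  simp [pieces]

lemma piece_subset_pieces {I : Finset ℤ} {k : ℤ} (h : k ∈ I) : D.piece k ⊆ D.pieces I :=
  fun _ hz => D.mem_pieces.2 ⟨k, h, hz⟩

lemma pieces_mono {I J : Finset ℤ} (h : I ⊆ J) : D.pieces I ⊆ D.pieces J := fun _ hz =>
  let ⟨k, hk, hz⟩ := D.mem_pieces.1 hz
  D.mem_pieces.2 ⟨k, h hk, hz⟩

lemma isCompact_pieces (I : Finset ℤ) : IsCompact (D.pieces I) :=
  I.isCompact_biUnion fun k _ => D.isCompact_piece k

lemma ne_zero_of_mem_pieces {I : Finset ℤ} {z : ℂ} (h : z ∈ D.pieces I) : z ≠ 0 := by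
  obtain ⟨k, -, hk⟩ := D.mem_pieces.1 h
  exact D.ne_zero_of_mem_piece hk

/-- Pieces are added in order of decreasing index: a piece of smaller index meets all the later ones
in its joint at most, so no cycle is ever closed. -/
lemma logAcyclic_pieces (I : Finset ℤ) : LogAcyclic (D.pieces I) := by
  induction I using Finset.induction_on_min with
  | empty =>
    intro h _ _
    exact ⟨0, by simp [pieces], by simp [pieces]⟩
  | insert j I hI ih =>
    have h1 : D.pieces (insert j I) = D.piece j ∪ D.pieces I := by
      simp [pieces]
    rw [h1]
    intro h hc h0
    refine (D.logAcyclic_piece j h (hc.mono subset_union_left)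
      fun z hz => h0 z (Or.inl hz)).union (D.isCompact_piece j).isClosed
      (D.isCompact_pieces I).isClosed
      (ih h (hc.mono subset_union_right) fun z hz => h0 z (Or.inr hz)) (a := D.joint j) ?_
    rintro z ⟨hz, hz'⟩
    obtain ⟨k, hk, hzk⟩ := D.mem_pieces.1 hz'
    exact (D.piece_inter (hI k hk) hz hzk).2

end PeriodicTail

/-! ### Strands of the locus and their common rotation. -/

namespace PeriodicTail

variable (D : PeriodicTail)

/-- The forward orbits of `j` and `k` under `D.nxt` meet. -/
def Merge (j k : ℤ) : Prop := ∃ a b : ℕ, D.nxt^[a] j = D.nxt^[b] k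

variable {D}

lemma Merge.refl (j : ℤ) : D.Merge j j := ⟨0, 0, rfl⟩

lemma Merge.symm {j k : ℤ} : D.Merge j k → D.Merge k j := fun ⟨a, b, h⟩ => ⟨b, a, h.symm⟩

lemma Merge.trans {j k l : ℤ} : D.Merge j k → D.Merge k l → D.Merge j l := by
  rintro ⟨a, b, h⟩ ⟨a', b', h'⟩
  refine ⟨a' + a, b + b', ?_⟩
  rw [Function.iterate_add_apply, h, Function.iterate_add_apply, ← h', ← Function.iterate_add_apply,
    ← Function.iterate_add_apply, add_comm]

lemma merge_iterate (j : ℤ) (a : ℕ) : D.Merge j (D.nxt^[a] j) := ⟨a, 0, rfl⟩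

lemma iterate_nxt_add (j m : ℤ) (a : ℕ) : D.nxt^[a] (j + D.p * m) = D.nxt^[a] j + D.p * m := by
  induction a with
  | zero => rfl
  | succ a ih => rw [Function.iterate_succ_apply', ih, D.nxt_add, Function.iterate_succ_apply']

lemma Merge.add {j k : ℤ} (h : D.Merge j k) (m : ℤ) :
    D.Merge (j + D.p * m) (k + D.p * m) := by
  obtain ⟨a, b, h⟩ := h
  exact ⟨a, b, by rw [iterate_nxt_add, iterate_nxt_add, h]⟩

lemma strictMono_iterate_nxt (j : ℤ) : StrictMono fun a => D.nxt^[a] j :=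
  strictMono_nat_of_lt_succ fun a => by
    rw [Function.iterate_succ_apply']; exact D.lt_nxt _

/-- Two terms of the orbit of `j` agree modulo `p` by the pigeonhole principle, and `nxt` commutes
with translation by periods. -/
lemma exists_merge_shift (j : ℤ) : ∃ m : ℕ, 0 < m ∧ D.Merge j (j + D.p * m) := by
  have : NeZero D.p := ⟨D.p_pos.ne'⟩
  obtain ⟨a, b, hab, h⟩ := Finite.exists_ne_map_eq_of_infinite
    fun a : ℕ => ((D.nxt^[a] j : ℤ) : ZMod D.p)
  wlog hlt : a < b generalizing a b
  · exact this b a hab.symm h.symm (by omega)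
  obtain ⟨m, hm⟩ := (ZMod.intCast_eq_intCast_iff_dvd_sub _ _ _).1 h
  have hpos : 0 < D.nxt^[b] j - D.nxt^[a] j := sub_pos.2 (strictMono_iterate_nxt j hlt)
  have hp : (0 : ℤ) < D.p := by exact_mod_cast D.p_pos
  have hm0 : 0 < m := by
    rw [hm] at hpos
    exact pos_of_mul_pos_right hpos hp.le
  refine ⟨m.toNat, by omega, b, a, ?_⟩
  rw [iterate_nxt_add, Int.toNat_of_nonneg hm0.le, ← hm]
  ring

lemma Merge.shift_mul {j : ℤ} {m : ℕ} (h : D.Merge j (j + D.p * m)) (n : ℕ) :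
    D.Merge j (j + D.p * (m * n : ℕ)) := by
  induction n with
  | zero => simpa using Merge.refl j
  | succ n ih =>
    refine ih.trans ?_
    have := h.add (m * n : ℕ)
    rwa [show j + D.p * m + (D.p : ℤ) * (m * n : ℕ) = j + D.p * (m * (n + 1) : ℕ) by
      push_cast; ring] at this

variable (D) in
lemma exists_common_shift : ∃ N : ℕ, 0 < N ∧ ∀ j, D.Merge j (j + D.p * N) := by
  choose m hm hmerge using fun j => exists_merge_shift (D := D) j
  refine ⟨∏ r ∈ Finset.range D.p, m r, Finset.prod_pos fun r _ => hm r, fun j => ?_⟩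
  obtain ⟨r, hr, t, rfl⟩ := D.exists_reduce j
  obtain ⟨n, hn⟩ := Finset.dvd_prod_of_mem (fun r : ℕ => m r) (Finset.mem_range.2 hr)
  have := ((hmerge r).shift_mul n).add t
  rw [hn]
  rwa [show (r : ℤ) + D.p * (m r * n : ℕ) + D.p * t = r + D.p * t + D.p * (m r * n : ℕ) by ring]
    at this

lemma disjoint_of_not_merge {j k : ℤ} (h : ¬ D.Merge j k) {z : ℂ} (hj : z ∈ D.piece j)
    (hk : z ∈ D.piece k) : False := by
  rcases lt_trichotomy j k with hlt | rfl | hlt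
  · exact h ⟨1, 0, (D.piece_inter hlt hj hk).1.symm⟩
  · exact h (Merge.refl j)
  · exact h ⟨0, 1, (D.piece_inter hlt hk hj).1⟩

variable (D) in
/-- The first `a + 1` terms of the orbit of `j`. -/
def chain (j : ℤ) (a : ℕ) : Finset ℤ := (Finset.range (a + 1)).image fun i => D.nxt^[i] j

lemma iterate_mem_chain (j : ℤ) {i a : ℕ} (h : i ≤ a) : D.nxt^[i] j ∈ D.chain j a :=
  Finset.mem_image.2 ⟨i, Finset.mem_range.2 (by omega), rfl⟩

lemma pieces_union (I J : Finset ℤ) : D.pieces (I ∪ J) = D.pieces I ∪ D.pieces J := by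
  ext z
  simp only [mem_pieces, mem_union, Finset.mem_union, or_and_right, exists_or]

lemma isPreconnected_chain (j : ℤ) (a : ℕ) : IsPreconnected (D.pieces (D.chain j a)) := by
  induction a with
  | zero => simpa [chain, pieces] using D.isPreconnected_piece j
  | succ a ih =>
    have h1 : D.chain j (a + 1) = D.chain j a ∪ {D.nxt^[a + 1] j} := by
      simp only [chain]
      rw [Finset.range_add_one, Finset.image_insert, Finset.insert_eq, Finset.union_comm]
    rw [h1, pieces_union]
    refine IsPreconnected.union (D.joint (D.nxt^[a] j))
      (D.piece_subset_pieces (iterate_mem_chain j le_rfl) (D.joint_mem_piece _)) ?_ ih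
      (by simpa [pieces] using D.isPreconnected_piece _)
    refine D.piece_subset_pieces (Finset.mem_singleton_self _) ?_
    rw [Function.iterate_succ_apply']
    exact D.joint_mem_piece_nxt _

lemma Merge.exists_link {j k : ℤ} (h : D.Merge j k) : ∃ I : Finset ℤ, j ∈ I ∧ k ∈ I ∧
    IsPreconnected (D.pieces I) ∧ ∀ i ∈ I, D.Merge j i := by
  obtain ⟨a, b, hab⟩ := h
  refine ⟨D.chain j a ∪ D.chain k b, Finset.mem_union_left _ (iterate_mem_chain j a.zero_le),
    Finset.mem_union_right _ (iterate_mem_chain k b.zero_le), ?_, ?_⟩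
  · rw [pieces_union]
    refine IsPreconnected.union (D.joint (D.nxt^[a] j))
      (D.piece_subset_pieces (iterate_mem_chain j le_rfl) (D.joint_mem_piece _)) ?_
      (isPreconnected_chain j a) (isPreconnected_chain k b)
    rw [hab]
    exact D.piece_subset_pieces (iterate_mem_chain k le_rfl) (D.joint_mem_piece _)
  · intro i hi
    rcases Finset.mem_union.1 hi with hi | hi
    · obtain ⟨n, -, rfl⟩ := Finset.mem_image.1 hi
      exact merge_iterate j n
    · obtain ⟨n, -, rfl⟩ := Finset.mem_image.1 hi
      exact Merge.trans ⟨a, b, hab⟩ (merge_iterate k n)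

variable (D) in
/-- Translation of a set of indices by `m` periods. -/
def shift (I : Finset ℤ) (m : ℤ) : Finset ℤ := I.image fun i => i + D.p * m

lemma add_mem_shift {I : Finset ℤ} {i : ℤ} (h : i ∈ I) (m : ℤ) : i + D.p * m ∈ D.shift I m :=
  Finset.mem_image_of_mem _ h

lemma pieces_shift (I : Finset ℤ) (m : ℤ) :
    D.pieces (D.shift I m) = (fun z => D.lam ^ (D.p * m) * z) '' D.pieces I := by
  ext z
  constructor
  · intro h
    obtain ⟨k, hk, hz⟩ := D.mem_pieces.1 h
    obtain ⟨i, hi, rfl⟩ := Finset.mem_image.1 hk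
    refine ⟨(D.lam ^ (D.p * m))⁻¹ * z, D.mem_pieces.2 ⟨i, hi, (D.mul_mem_piece_iff m).1 ?_⟩,
      mul_inv_cancel_left₀ (zpow_ne_zero _ D.lam_ne) z⟩
    rwa [mul_inv_cancel_left₀ (zpow_ne_zero _ D.lam_ne)]
  · rintro ⟨w, hw, rfl⟩
    obtain ⟨k, hk, hz⟩ := D.mem_pieces.1 hw
    exact D.mem_pieces.2 ⟨_, add_mem_shift hk m, (D.mul_mem_piece_iff m).2 hz⟩

lemma isPreconnected_shift {I : Finset ℤ} (h : IsPreconnected (D.pieces I)) (m : ℤ) :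
    IsPreconnected (D.pieces (D.shift I m)) := by
  rw [pieces_shift]
  exact h.image _ (by fun_prop)

variable (D) in
/-- Connected finite unions of pieces linking `D.piece j` to its image under multiplication by
`lam ^ (p * N)`. -/
structure Links where
  N : ℕ
  N_pos : 0 < N
  H : ℤ
  J : ℤ → Finset ℤ
  mem : ∀ j, j ∈ J j
  mem_add : ∀ j, j + D.p * N ∈ J j
  isPreconnected : ∀ j, IsPreconnected (D.pieces (J j))
  merge : ∀ j, ∀ i ∈ J j, D.Merge j i
  le : ∀ j, ∀ i ∈ J j, i ≤ j + H

variable (D) in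
-- Links are chosen for the indices `0, …, p - 1` only and translated to all others; this is what
-- makes the bound `H` uniform in `j`.
lemma nonempty_links : Nonempty D.Links := by
  obtain ⟨N, hN, hmerge⟩ := D.exists_common_shift
  choose I hI₁ hI₂ hI₃ hI₄ using fun j => (hmerge j).exists_link
  obtain ⟨H, hH⟩ := ((Finset.range D.p).biUnion fun r => I r).bddAbove
  choose r hr m hm using D.exists_reduce
  refine ⟨⟨N, hN, H, fun j => D.shift (I (r j)) (m j), ?_, ?_, ?_, ?_, ?_⟩⟩
  · intro j
    have := add_mem_shift (D := D) (hI₁ (r j)) (m j)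
    rwa [← hm j] at this
  · intro j
    have := add_mem_shift (D := D) (hI₂ (r j)) (m j)
    rwa [add_right_comm, ← hm j] at this
  · exact fun j => isPreconnected_shift (hI₃ _) _
  · intro j i hi
    obtain ⟨k, hk, rfl⟩ := Finset.mem_image.1 hi
    have := (hI₄ (r j) k hk).add (m j)
    rwa [← hm j] at this
  · intro j i hi
    obtain ⟨k, hk, rfl⟩ := Finset.mem_image.1 hi
    have := hH (Finset.mem_coe.2 (Finset.mem_biUnion.2 ⟨r j, Finset.mem_range.2 (hr j), hk⟩))
    have := hm j
    omega

namespace Links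

variable (S : D.Links)

/-- The scaling factor of `N` periods. -/
def nu : ℂ := D.lam ^ (D.p * S.N : ℤ)

lemma nu_ne : S.nu ≠ 0 := zpow_ne_zero _ D.lam_ne

lemma norm_nu_lt : ‖S.nu‖ < 1 := by
  have h : (D.p * S.N : ℤ) = ((D.p * S.N : ℕ) : ℤ) := by push_cast; rfl
  rw [nu, h, zpow_natCast, norm_pow]
  exact pow_lt_one₀ (norm_nonneg _) D.norm_lt (Nat.mul_pos D.p_pos S.N_pos).ne'

lemma nu_mul_mem_piece {j : ℤ} {z : ℂ} (hz : z ∈ D.piece j) :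
    S.nu * z ∈ D.piece (j + D.p * S.N) := (D.mul_mem_piece_iff (S.N : ℤ)).2 hz

lemma nu_mul_mem {j : ℤ} {z : ℂ} (hz : z ∈ D.piece j) : S.nu * z ∈ D.pieces (S.J j) :=
  D.piece_subset_pieces (S.mem_add j) (S.nu_mul_mem_piece hz)

lemma piece_subset (j : ℤ) : D.piece j ⊆ D.pieces (S.J j) := D.piece_subset_pieces (S.mem j)

/-- `κ` is the change of the logarithm from `z` to `nu * z` along the link of `z ∈ D.piece j`. -/
def IsRotation (j : ℤ) (κ : ℂ) : Prop := ∀ β : ℂ → ℂ, ContinuousOn β (D.pieces (S.J j)) →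
  (∀ z ∈ D.pieces (S.J j), Complex.exp (β z) = z) → ∀ z ∈ D.piece j, β (S.nu * z) - β z = κ

lemma exists_log (I : Finset ℤ) : ∃ β : ℂ → ℂ, ContinuousOn β (D.pieces I) ∧
    ∀ z ∈ D.pieces I, Complex.exp (β z) = z :=
  D.logAcyclic_pieces I id continuousOn_id fun _ hz => D.ne_zero_of_mem_pieces hz

/-- The change does not depend on the logarithm, since two of them differ by a constant on the
connected link, nor on `z`, since it is a logarithm of the constant `nu` on the connected piece. -/
lemma exists_isRotation (j : ℤ) : ∃ κ, S.IsRotation j κ := by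
  obtain ⟨β₀, hβ₀, e₀⟩ := exists_log (D := D) (S.J j)
  refine ⟨β₀ (S.nu * D.joint j) - β₀ (D.joint j), fun β hβ e z hz => ?_⟩
  have h1 : β (S.nu * z) - β₀ (S.nu * z) = β z - β₀ z :=
    sub_eq_sub_of_logs (S.isPreconnected j) hβ hβ₀ e e₀ (S.nu_mul_mem hz) (S.piece_subset j hz)
  have h2 : β₀ (S.nu * z) - β₀ z = β₀ (S.nu * D.joint j) - β₀ (D.joint j) := by
    refine eq_of_exp_eq_const (f := fun z => β₀ (S.nu * z) - β₀ z) (w := S.nu)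
      (D.isPreconnected_piece j) ?_ ?_ hz (D.joint_mem_piece j)
    · exact (hβ₀.comp (by fun_prop) fun w hw => S.nu_mul_mem hw).sub (hβ₀.mono (S.piece_subset j))
    · intro w hw
      rw [Complex.exp_sub, e₀ _ (S.nu_mul_mem hw), e₀ _ (S.piece_subset j hw),
        mul_div_cancel_right₀ _ (D.ne_zero_of_mem_piece hw)]
  linear_combination h1 + h2

/-- One logarithm on the union of both links computes both changes at the common joint. -/
lemma IsRotation.eq_nxt {j : ℤ} {κ κ' : ℂ} (h : S.IsRotation j κ)
    (h' : S.IsRotation (D.nxt j) κ') : κ = κ' := by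
  obtain ⟨β, hβ, e⟩ := exists_log (D := D) (S.J j ∪ S.J (D.nxt j))
  have s1 := D.pieces_mono (I := S.J j) (J := S.J j ∪ S.J (D.nxt j)) Finset.subset_union_left
  have s2 := D.pieces_mono (I := S.J (D.nxt j)) (J := S.J j ∪ S.J (D.nxt j))
    Finset.subset_union_right
  rw [← h β (hβ.mono s1) (fun z hz => e z (s1 hz)) _ (D.joint_mem_piece j),
    ← h' β (hβ.mono s2) (fun z hz => e z (s2 hz)) _ (D.joint_mem_piece_nxt j)]

/-- The rotation of the link at `j`. -/
def rot (j : ℤ) : ℂ := (S.exists_isRotation j).choose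

lemma isRotation_rot (j : ℤ) : S.IsRotation j (S.rot j) := (S.exists_isRotation j).choose_spec

lemma rot_iterate (j : ℤ) (a : ℕ) : S.rot (D.nxt^[a] j) = S.rot j := by
  induction a with
  | zero => rfl
  | succ a ih =>
    rw [Function.iterate_succ_apply', ← ih]
    exact ((S.isRotation_rot _).eq_nxt S (S.isRotation_rot _)).symm

lemma rot_eq_of_merge {j k : ℤ} (h : D.Merge j k) : S.rot j = S.rot k := by
  obtain ⟨a, b, h⟩ := h
  rw [← S.rot_iterate j a, h, S.rot_iterate]

/-- When `z'` is smaller than `z`, the factor `(z - z') / z` lies in the slit plane. Dividing it out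
by its principal logarithm turns a logarithm of `z - z'` into one of `z`; the factor itself is
unchanged when both variables are scaled by `nu`. -/
lemma diff_eq_rot {j : ℤ} {W W' C : Set ℂ} {Λ : ℂ × ℂ → ℂ} (hΛ : ContinuousOn Λ (W ×ˢ W'))
    (eΛ : ∀ q ∈ W ×ˢ W', Complex.exp (Λ q) = q.1 - q.2) (hW : D.pieces (S.J j) ⊆ W)
    (hC : C ⊆ W') (hCc : IsPreconnected C) {z z' : ℂ} (hz : z ∈ D.piece j) (hz' : z' ∈ C)
    (hnz' : S.nu * z' ∈ C) (hlt : ∀ w ∈ D.pieces (S.J j), ∀ w' ∈ C, ‖w'‖ < ‖w‖) :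
    Λ (S.nu * z, S.nu * z') - Λ (z, z') = S.rot j := by
  have hslit : ∀ w ∈ D.pieces (S.J j), ∀ w' ∈ C, (w - w') / w ∈ Complex.slitPlane := by
    intro w hw w' hw'
    refine div_mem_slitPlane ?_
    rw [sub_sub_cancel_left, norm_neg]
    exact hlt w hw w' hw'
  have hne : ∀ w ∈ D.pieces (S.J j), w ≠ 0 := fun w hw => D.ne_zero_of_mem_pieces hw
  have hne' : ∀ w ∈ D.pieces (S.J j), ∀ w' ∈ C, w - w' ≠ 0 := fun w hw w' hw' h => by
    have := Complex.slitPlane_ne_zero (hslit w hw w' hw')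
    rw [h, zero_div] at this
    exact this rfl
  have hnz := S.nu_mul_mem hz
  have h1 := S.isRotation_rot j (fun w => Λ (w, z') - Complex.log ((w - z') / w)) (by
    refine ContinuousOn.sub (hΛ.comp (by fun_prop) fun w hw => ⟨hW hw, hC hz'⟩) ?_
    refine ContinuousOn.clog ?_ fun w hw => hslit w hw z' hz'
    exact ContinuousOn.div (by fun_prop) (by fun_prop) hne) (by
    intro w hw
    rw [Complex.exp_sub, eΛ (w, z') ⟨hW hw, hC hz'⟩, Complex.exp_log
      (Complex.slitPlane_ne_zero (hslit w hw z' hz')), div_div_cancel₀ (hne' w hw z' hz')]) z hz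
  have h2 := eq_of_exp_eq_const (w := S.nu * z) (x := z') (y := S.nu * z')
    (f := fun w' => Λ (S.nu * z, w') - Complex.log ((S.nu * z - w') / (S.nu * z))) hCc (by
    refine ContinuousOn.sub (hΛ.comp (by fun_prop) fun w hw => ⟨hW hnz, hC hw⟩) ?_
    exact ContinuousOn.clog (by fun_prop) fun w hw => hslit _ hnz w hw) (by
    intro w hw
    rw [Complex.exp_sub, eΛ (S.nu * z, w) ⟨hW hnz, hC hw⟩, Complex.exp_log
      (Complex.slitPlane_ne_zero (hslit _ hnz w hw)), div_div_cancel₀ (hne' _ hnz w hw)]) hz' hnz'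
  have h3 : (S.nu * z - S.nu * z') / (S.nu * z) = (z - z') / z := by
    rw [← mul_sub, mul_div_mul_left _ _ S.nu_ne]
  simp only [h3] at h1 h2
  linear_combination h1 - h2

/-- The union of the first `n + 1` scaled copies of the link at `j`. -/
def tower (j : ℤ) (n : ℕ) : Finset ℤ :=
  (Finset.range (n + 1)).biUnion fun i => D.shift (S.J j) (S.N * i)

lemma shift_subset_tower (j : ℤ) {i n : ℕ} (h : i ≤ n) :
    D.shift (S.J j) (S.N * i) ⊆ S.tower j n :=
  Finset.subset_biUnion_of_mem (fun i : ℕ => D.shift (S.J j) (S.N * i))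
    (Finset.mem_range.2 (by omega))

lemma tower_succ (j : ℤ) (n : ℕ) :
    S.tower j (n + 1) = S.tower j n ∪ D.shift (S.J j) (S.N * (n + 1 : ℕ)) := by
  rw [tower, Finset.range_add_one, Finset.biUnion_insert, Finset.union_comm]
  rfl

lemma isPreconnected_tower (j : ℤ) (n : ℕ) : IsPreconnected (D.pieces (S.tower j n)) := by
  induction n with
  | zero =>
    have : S.tower j 0 = D.shift (S.J j) 0 := by simp [tower]
    rw [this]
    exact isPreconnected_shift (S.isPreconnected j) 0
  | succ n ih =>
    rw [tower_succ, pieces_union]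
    have h1 := add_mem_shift (D := D) (S.mem_add j) (S.N * n)
    have h2 := add_mem_shift (D := D) (S.mem j) (S.N * (n + 1 : ℕ))
    rw [show j + (D.p : ℤ) * S.N + D.p * (S.N * n) = j + D.p * (S.N * (n + 1 : ℕ)) by
      push_cast; ring] at h1
    have h3 := D.joint_mem_piece (j + D.p * (S.N * (n + 1 : ℕ)))
    exact IsPreconnected.union _ (D.piece_subset_pieces (S.shift_subset_tower j le_rfl h1) h3)
      (D.piece_subset_pieces h2 h3) ih (isPreconnected_shift (S.isPreconnected j) _)

lemma merge_of_mem_tower {j i : ℤ} {n : ℕ} (h : i ∈ S.tower j n) : D.Merge j i := by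
  obtain ⟨m, -, hm⟩ := Finset.mem_biUnion.1 h
  obtain ⟨k, hk, rfl⟩ := Finset.mem_image.1 hm
  have h1 := (S.merge j _ (S.mem_add j)).shift_mul m
  have h2 := (S.merge j k hk).add (S.N * m)
  push_cast at h1
  exact h1.trans h2

lemma nu_pow (n : ℕ) : S.nu ^ n = D.lam ^ (D.p * (S.N * n) : ℤ) := by
  rw [nu, ← zpow_natCast, ← zpow_mul]; congr 1; ring

lemma nu_pow_mul_mem_tower {j : ℤ} {i n : ℕ} (h : i ≤ n) {z : ℂ} (hz : z ∈ D.pieces (S.J j)) :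
    S.nu ^ i * z ∈ D.pieces (S.tower j n) := by
  refine D.pieces_mono (S.shift_subset_tower j h) ?_
  rw [pieces_shift, S.nu_pow]
  exact ⟨z, hz, rfl⟩

lemma nu_mul_mem_tower {j : ℤ} {n : ℕ} {z : ℂ} (hz : z ∈ D.pieces (S.tower j n)) :
    S.nu * z ∈ D.pieces (S.tower j (n + 1)) := by
  obtain ⟨k, hk, hzk⟩ := D.mem_pieces.1 hz
  obtain ⟨i, hi, hki⟩ := Finset.mem_biUnion.1 hk
  have h1 : z ∈ D.pieces (D.shift (S.J j) (S.N * i)) := D.piece_subset_pieces hki hzk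
  rw [pieces_shift, ← S.nu_pow] at h1
  obtain ⟨w, hw, rfl⟩ := h1
  have := S.nu_pow_mul_mem_tower (i := i + 1) (n := n + 1)
    (by rw [Finset.mem_range] at hi; omega) hw
  rwa [pow_succ', mul_assoc] at this

/-- The preconnected set `nu ^ n * C` for the link `C` at `j`. -/
lemma isPreconnected_scaled (j : ℤ) (n : ℕ) :
    IsPreconnected ((fun z => S.nu ^ n * z) '' D.pieces (S.J j)) :=
  (S.isPreconnected j).image _ (by fun_prop)

lemma exists_norm_scaled_lt (j k : ℤ) : ∃ n : ℕ, ∀ m ≥ n, ∀ w ∈ D.pieces (S.J j),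
    ∀ w' ∈ (fun z => S.nu ^ m * z) '' D.pieces (S.J k), ‖w'‖ < ‖w‖ := by
  obtain ⟨R, hR⟩ := (D.isCompact_pieces (S.J k)).isBounded.exists_norm_le
  obtain ⟨x, hx, hmin⟩ := (D.isCompact_pieces (S.J j)).exists_isMinOn
    ⟨_, S.piece_subset j (D.joint_mem_piece j)⟩ continuous_norm.continuousOn
  have h1 : Tendsto (fun m : ℕ => ‖S.nu‖ ^ m * R) atTop (𝓝 0) := by
    simpa using (tendsto_pow_atTop_nhds_zero_of_lt_one (norm_nonneg _) S.norm_nu_lt).mul_const R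
  obtain ⟨n, hn⟩ := eventually_atTop.1
    (h1.eventually (gt_mem_nhds (norm_pos_iff.2 (D.ne_zero_of_mem_pieces hx))))
  refine ⟨n, fun m hm w hw => ?_⟩
  rintro _ ⟨z, hz, rfl⟩
  rw [norm_mul, norm_pow]
  exact ((mul_le_mul_of_nonneg_left (hR z hz) (by positivity)).trans_lt (hn m hm)).trans_le
    (hmin hw)

/-- The two strands are disjoint, so `z - z'` has a logarithm on the product of long connected
stretches of them. Its change under scaling both variables by `nu` is constant; it equals one
rotation where `z'` is small and the other where `z` is small. -/
lemma rot_eq_of_not_merge {j k : ℤ} (h : ¬ D.Merge j k) : S.rot j = S.rot k := by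
  obtain ⟨n₁, hn₁⟩ := S.exists_norm_scaled_lt j k
  obtain ⟨n₂, hn₂⟩ := S.exists_norm_scaled_lt k j
  let n := max n₁ n₂
  let W := D.pieces (S.tower j (n + 1))
  let W' := D.pieces (S.tower k (n + 1))
  have hdisj : ∀ q ∈ W ×ˢ W', q.1 - q.2 ≠ 0 := by
    rintro ⟨w, w'⟩ ⟨hw, hw'⟩ h0
    have heq : w = w' := sub_eq_zero.1 h0
    simp only at hw hw'
    subst heq
    obtain ⟨a, ha, hwa⟩ := D.mem_pieces.1 hw
    obtain ⟨b, hb, hwb⟩ := D.mem_pieces.1 hw'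
    exact disjoint_of_not_merge (fun hab => h ((S.merge_of_mem_tower ha).trans
      (hab.trans (S.merge_of_mem_tower hb).symm))) hwa hwb
  have hj := D.joint_mem_piece j
  have hk := D.joint_mem_piece k
  have hjJ := S.piece_subset j hj
  have hkJ := S.piece_subset k hk
  have hsub : ∀ i, D.pieces (S.J i) ⊆ D.pieces (S.tower i (n + 1)) := fun i z hz => by
    simpa using S.nu_pow_mul_mem_tower (i := 0) (n := n + 1) (by omega) hz
  obtain ⟨Λ, hΛ, eΛ⟩ := (D.logAcyclic_pieces (S.tower j (n + 1))).prod (D.isCompact_pieces _)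
    (S.isPreconnected_tower j (n + 1)) ⟨_, hsub j hjJ⟩
    (D.logAcyclic_pieces (S.tower k (n + 1))) (fun q => q.1 - q.2) (by fun_prop) hdisj
  have hmono : ∀ i, D.pieces (S.tower i n) ⊆ D.pieces (S.tower i (n + 1)) := fun i => by
    rw [tower_succ]; exact D.pieces_mono Finset.subset_union_left
  -- The base points compared are one where the second coordinate is scaled down by `nu ^ n` and one
  -- where the first is.
  have hconst := eq_of_exp_eq_const (w := S.nu)
    (f := fun q : ℂ × ℂ => Λ (S.nu * q.1, S.nu * q.2) - Λ q)
    ((S.isPreconnected_tower j n).prod (S.isPreconnected_tower k n)) (by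
      refine ContinuousOn.sub (hΛ.comp (by fun_prop) fun q hq => ?_) (hΛ.mono ?_)
      · exact ⟨S.nu_mul_mem_tower hq.1, S.nu_mul_mem_tower hq.2⟩
      · exact prod_mono (hmono j) (hmono k)) (by
      intro q hq
      have hq' : q ∈ W ×ˢ W' := ⟨hmono j hq.1, hmono k hq.2⟩
      rw [Complex.exp_sub, eΛ _ ⟨S.nu_mul_mem_tower hq.1, S.nu_mul_mem_tower hq.2⟩, eΛ q hq']
      simp only
      rw [← mul_sub, mul_div_cancel_right₀ _ (hdisj q hq')])
    (x := (D.joint j, S.nu ^ n * D.joint k)) (y := (S.nu ^ n * D.joint j, D.joint k))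
    ⟨by simpa using S.nu_pow_mul_mem_tower (i := 0) n.zero_le hjJ,
      S.nu_pow_mul_mem_tower le_rfl hkJ⟩
    ⟨S.nu_pow_mul_mem_tower le_rfl hjJ,
      by simpa using S.nu_pow_mul_mem_tower (i := 0) n.zero_le hkJ⟩
  have hscaled : ∀ i, (fun z => S.nu ^ n * z) '' D.pieces (S.J i) ⊆
      D.pieces (S.tower i (n + 1)) := by
    rintro i _ ⟨z, hz, rfl⟩
    exact S.nu_pow_mul_mem_tower (by omega) hz
  have hmul : ∀ i, S.nu * (S.nu ^ n * D.joint i) ∈ (fun z => S.nu ^ n * z) '' D.pieces (S.J i) :=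
    fun i => ⟨S.nu * D.joint i, S.nu_mul_mem (D.joint_mem_piece i), by ring⟩
  have h1 := S.diff_eq_rot hΛ eΛ (hsub j) (hscaled k) (S.isPreconnected_scaled k n) hj
    ⟨_, hkJ, rfl⟩ (hmul k) (hn₁ n (le_max_left _ _))
  -- Exchanging the roles of the strands changes the sign of `z - z'`, hence the shift by `πi`,
  -- which cancels in the difference.
  have h2 := S.diff_eq_rot (Λ := fun q => Λ (q.2, q.1) - Real.pi * Complex.I) (W := W') (W' := W)
    ((hΛ.comp (by fun_prop) fun q hq => ⟨hq.2, hq.1⟩).sub continuousOn_const)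
    (by
      intro q hq
      rw [Complex.exp_sub, eΛ _ ⟨hq.2, hq.1⟩, Complex.exp_pi_mul_I]
      simp only
      ring) (hsub k) (hscaled j) (S.isPreconnected_scaled j n) hk
    ⟨_, hjJ, rfl⟩ (hmul j) (hn₂ n (le_max_right _ _))
  simp only at h1 h2 hconst
  linear_combination hconst - h1 + h2

lemma rot_eq (j k : ℤ) : S.rot j = S.rot k := by
  by_cases h : D.Merge j k
  · exact S.rot_eq_of_merge h
  · exact S.rot_eq_of_not_merge h

end Links
end PeriodicTail

/-! ### Logarithms on the whole locus, inversion, and a path in the complement. -/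

namespace PeriodicTail

variable {D : PeriodicTail}

/-- Logarithms on the nested connected tails, normalized at the common point 0, agree where they
overlap; continuity is local, and in a bounded region the locus is a single tail. -/
lemma exists_log_locus {x : ℂ} (hx : x ∉ D.locus) :
    ∃ L : ℂ → ℂ, ContinuousOn L D.locus ∧ ∀ z ∈ D.locus, Complex.exp (L z) = z - x := by
  classical
  have h1 : ∀ k : ℤ, ∃ L : ℂ → ℂ, ContinuousOn L (D.tail k) ∧
      (∀ z ∈ D.tail k, Complex.exp (L z) = z - x) ∧ L 0 = Complex.log (-x) := by
    intro k
    have hne : ∀ z ∈ D.tail k, z - x ≠ 0 := fun z hz h =>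
      hx (mem_iUnion.2 ⟨k, sub_eq_zero.1 h ▸ hz⟩)
    obtain ⟨L, hL, e⟩ := D.logAcyclic_cyl 0 k (fun z => z - x) (by fun_prop) hne
    have h0 := D.zero_mem_tail k
    refine ⟨fun z => L z - L 0 + Complex.log (-x), (hL.sub continuousOn_const).add
      continuousOn_const, fun z hz => ?_, by ring⟩
    have hx0 : -x ≠ 0 := by simpa using hne 0 h0
    rw [Complex.exp_add, Complex.exp_sub, e z hz, e 0 h0, Complex.exp_log hx0]
    simp only [zero_sub, div_mul_cancel₀ _ hx0]
  choose L hL eL hL0 using h1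
  have hcomp : ∀ j k, j ≤ k → ∀ z ∈ D.tail k, L j z = L k z := by
    intro j k hjk z hz
    have hs := D.tail_subset_tail hjk
    have := sub_eq_sub_of_logs (D.isPreconnected_cyl 0 k) ((hL j).mono hs) (hL k)
      (fun z hz => eL j z (hs hz)) (eL k) hz (D.zero_mem_tail k)
    rw [hL0, hL0, sub_self] at this
    exact sub_eq_zero.1 this
  let M : ℂ → ℂ := fun z => if h : ∃ k, z ∈ D.tail k then L h.choose z else 0
  have hM : ∀ k, ∀ z ∈ D.tail k, M z = L k z := by
    intro k z hz
    have h : ∃ k, z ∈ D.tail k := ⟨k, hz⟩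
    simp only [M, dif_pos h]
    rcases le_total h.choose k with hle | hle
    · exact hcomp _ _ hle z hz
    · exact (hcomp _ _ hle z h.choose_spec).symm
  refine ⟨M, fun z hz => ?_, fun z hz => ?_⟩
  · obtain ⟨k, hk⟩ := D.exists_tail_of_norm_lt (‖z‖ + 1)
    have h2 : ContinuousWithinAt M (D.tail k) z :=
      ((hL k).congr (hM k)) z (hk z hz (by linarith))
    refine h2.mono_of_mem_nhdsWithin ?_
    have h3 : {w : ℂ | ‖w‖ < ‖z‖ + 1} ∈ 𝓝 z :=
      (isOpen_lt continuous_norm continuous_const).mem_nhds (by simp)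
    filter_upwards [mem_nhdsWithin_of_mem_nhds h3, self_mem_nhdsWithin] with w hw hw'
      using hk w hw' hw
  · obtain ⟨k, hk⟩ := mem_iUnion.1 hz
    rw [hM k z hk, eL k z hk]

namespace Links

variable (S : D.Links)

lemma nu_mul_mem_locus_iff {z : ℂ} : S.nu * z ∈ D.locus ↔ z ∈ D.locus :=
  D.mul_mem_locus_iff (S.N : ℤ)

lemma div_nu_mem_locus_iff {z : ℂ} : z / S.nu ∈ D.locus ↔ z ∈ D.locus := by
  rw [← S.nu_mul_mem_locus_iff, mul_div_cancel₀ _ S.nu_ne]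

lemma exp_rot (j : ℤ) : Complex.exp (S.rot j) = S.nu := by
  obtain ⟨β, hβ, e⟩ := exists_log (D := D) (S.J j)
  have hj := D.joint_mem_piece j
  rw [← S.isRotation_rot j β hβ e _ hj, Complex.exp_sub, e _ (S.nu_mul_mem hj),
    e _ (S.piece_subset j hj), mul_div_cancel_right₀ _ (D.ne_zero_of_mem_piece hj)]

/-- The indices in the link at `j` are at most `j + H`, so the link comes closer to 0 than the piece
only by a bounded factor. -/
lemma exists_norm_ge : ∃ δ > 0, ∀ j, ∀ z ∈ D.piece j, ∀ w ∈ D.pieces (S.J j), δ * ‖z‖ ≤ ‖w‖ := by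
  obtain ⟨δ, hδ, hle⟩ := D.exists_le_norm_piece
  have h1 : 0 < 1 - ‖D.lam‖ := sub_pos.2 D.norm_lt
  have hH := zpow_pos D.norm_pos S.H
  refine ⟨δ * ‖D.lam‖ ^ S.H * (1 - ‖D.lam‖), by positivity, fun j z hz w hw => ?_⟩
  obtain ⟨i, hi, hwi⟩ := D.mem_pieces.1 hw
  have h2 := D.norm_le_of_mem_piece hz
  have h3 := hle i w hwi
  have h4 : ‖D.lam‖ ^ (j + S.H) ≤ ‖D.lam‖ ^ i :=
    zpow_le_zpow_right_of_le_one₀ D.norm_pos D.norm_lt.le (S.le j i hi)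
  rw [zpow_add₀ D.norm_pos.ne'] at h4
  calc δ * ‖D.lam‖ ^ S.H * (1 - ‖D.lam‖) * ‖z‖
      ≤ δ * ‖D.lam‖ ^ S.H * (1 - ‖D.lam‖) * (‖D.lam‖ ^ j * (1 - ‖D.lam‖)⁻¹) :=
        mul_le_mul_of_nonneg_left h2 (by positivity)
    _ = δ * (‖D.lam‖ ^ j * ‖D.lam‖ ^ S.H) := by field_simp
    _ ≤ δ * ‖D.lam‖ ^ i := mul_le_mul_of_nonneg_left h4 hδ.le
    _ ≤ ‖w‖ := h3

/-- On a link outside the disc of radius `‖x‖`, removing the principal logarithm of `(w - x) / w`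
from `L` leaves a logarithm of `w`, to which the definition of the rotation applies. -/
lemma log_sub_log_eq {x : ℂ} {L : ℂ → ℂ} (hL : ContinuousOn L D.locus)
    (eL : ∀ z ∈ D.locus, Complex.exp (L z) = z - x) {j : ℤ} {z : ℂ} (hz : z ∈ D.piece j)
    (hlt : ∀ w ∈ D.pieces (S.J j), ‖x‖ < ‖w‖) :
    L (S.nu * z) - L z = S.rot j + (Complex.log ((S.nu * z - x) / (S.nu * z)) -
      Complex.log ((z - x) / z)) := by
  have hsub : D.pieces (S.J j) ⊆ D.locus := fun w hw => by
    obtain ⟨k, -, hk⟩ := D.mem_pieces.1 hw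
    exact D.mem_locus_iff.2 (Or.inr ⟨k, hk⟩)
  have hslit : ∀ w ∈ D.pieces (S.J j), (w - x) / w ∈ Complex.slitPlane := by
    intro w hw
    refine div_mem_slitPlane ?_
    rw [sub_sub_cancel_left, norm_neg]
    exact hlt w hw
  have := S.isRotation_rot j (fun w => L w - Complex.log ((w - x) / w)) (by
    refine (hL.mono hsub).sub (ContinuousOn.clog ?_ hslit)
    exact ContinuousOn.div (by fun_prop) (by fun_prop) fun w hw => D.ne_zero_of_mem_pieces hw) (by
    intro w hw
    rw [Complex.exp_sub, eL w (hsub hw), Complex.exp_log (Complex.slitPlane_ne_zero (hslit w hw)),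
      div_div_cancel₀]
    intro h0
    have h := Complex.slitPlane_ne_zero (hslit w hw)
    rw [h0, zero_div] at h
    exact h rfl) z hz
  linear_combination this

lemma tendsto_log_sub_div (x a : ℂ) (ha : a ≠ 0) :
    Tendsto (fun z => Complex.log ((a * z - x) / (a * z))) (Bornology.cobounded ℂ) (𝓝 0) := by
  have h1 : Tendsto (fun z : ℂ => 1 - x * a⁻¹ * z⁻¹) (Bornology.cobounded ℂ) (𝓝 1) := by
    simpa using (tendsto_inv₀_cobounded.const_mul (x * a⁻¹)).const_sub 1
  have h2 : Tendsto (fun z => Complex.log (1 - x * a⁻¹ * z⁻¹)) (Bornology.cobounded ℂ) (𝓝 0) := by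
    simpa using h1.clog (Complex.one_mem_slitPlane)
  refine h2.congr' ?_
  have h3 : ∀ᶠ z : ℂ in Bornology.cobounded ℂ, z ≠ 0 := Bornology.eventually_ne_cobounded 0
  filter_upwards [h3] with z hz
  congr 1
  field_simp

/-- On the locus, `(z - x / nu) / (z - x)` has a continuous logarithm vanishing at infinity. -/
lemma exists_log_quotient {x : ℂ} (hx : x ∉ D.locus) : ∃ G : ℂ → ℂ, ContinuousOn G D.locus ∧
    (∀ z ∈ D.locus, Complex.exp (G z) = (z - x / S.nu) / (z - x)) ∧
    Tendsto G (Bornology.cobounded ℂ ⊓ 𝓟 D.locus) (𝓝 0) := by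
  obtain ⟨L, hL, eL⟩ := exists_log_locus hx
  have hmem : ∀ z ∈ D.locus, S.nu * z ∈ D.locus := fun z hz => S.nu_mul_mem_locus_iff.2 hz
  refine ⟨fun z => L (S.nu * z) - L z - S.rot 0, ?_, ?_, ?_⟩
  · exact ((hL.comp (by fun_prop) hmem).sub hL).sub continuousOn_const
  · intro z hz
    rw [Complex.exp_sub, Complex.exp_sub, eL _ (hmem z hz), eL z hz, S.exp_rot]
    have := S.nu_ne
    have h2 : z - x ≠ 0 := fun h => hx (sub_eq_zero.1 h ▸ hz)
    field_simp
  · obtain ⟨δ, hδ, hle⟩ := S.exists_norm_ge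
    have h1 := (tendsto_log_sub_div x S.nu S.nu_ne).sub (tendsto_log_sub_div x 1 one_ne_zero)
    rw [sub_zero] at h1
    refine (h1.mono_left inf_le_left).congr' ?_
    have h2 : ∀ᶠ z : ℂ in Bornology.cobounded ℂ, ‖x‖ / δ < ‖z‖ :=
      tendsto_norm_cobounded_atTop.eventually_gt_atTop _
    filter_upwards [h2.filter_mono inf_le_left, mem_inf_of_right (mem_principal_self _)] with z hz hzl
    have hz0 : z ≠ 0 := norm_pos_iff.1 ((div_nonneg (norm_nonneg _) hδ.le).trans_lt hz)
    obtain ⟨j, hj⟩ := (D.mem_locus_iff.1 hzl).resolve_left hz0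
    -- Equality of all rotations enters here: without it the limit at infinity would depend on the
    -- strand containing `z`.
    rw [S.log_sub_log_eq hL eL hj fun w hw => ?_, S.rot_eq j 0]
    · rw [one_mul]; ring
    · rw [div_lt_iff₀ hδ] at hz
      linarith [hle j z hj w hw]

/-- The image of the locus, with the point at infinity, under inversion about `x`. -/
def inverted (D : PeriodicTail) (x : ℂ) : Set ℂ := {w | w = 0 ∨ x + w⁻¹ ∈ D.locus}

lemma exists_ball_subset {x : ℂ} (hx : x ∉ D.locus) : ∃ r > 0, Metric.ball x r ⊆ D.locusᶜ :=
  Metric.isOpen_iff.1 D.isClosed_locus.isOpen_compl x hx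

lemma isCompact_inverted {x : ℂ} (hx : x ∉ D.locus) : IsCompact (inverted D x) := by
  rw [Metric.isCompact_iff_isClosed_bounded]
  constructor
  · rw [← isOpen_compl_iff, isOpen_iff_mem_nhds]
    intro w hw
    simp only [inverted, mem_compl_iff, mem_ofPred_eq, not_or] at hw
    have hc : ContinuousAt (fun w : ℂ => x + w⁻¹) w := by fun_prop (disch := exact hw.1)
    have h1 := hc.preimage_mem_nhds (D.isClosed_locus.isOpen_compl.mem_nhds hw.2)
    filter_upwards [h1, isOpen_ne.mem_nhds hw.1] with v hv hv0
    simp only [inverted, mem_compl_iff, mem_ofPred_eq, not_or]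
    exact ⟨hv0, hv⟩
  · obtain ⟨r, hr, hball⟩ := exists_ball_subset hx
    refine isBounded_iff_forall_norm_le.2 ⟨r⁻¹, ?_⟩
    rintro w (rfl | hw)
    · simpa using hr.le
    · by_contra h
      push Not at h
      refine hball ?_ hw
      rw [mem_ball_iff_norm, add_sub_cancel_left, norm_inv]
      exact inv_lt_of_inv_lt₀ hr h

/-- With `z = x + 1/w` one has `w - q = -q (z - x/ν)/(z - x)`. The quotient has a logarithm on the
locus that tends to 0 at infinity, so it extends continuously by 0 to `w = 0`. -/
lemma hasLogOn_inverted {x : ℂ} (hx : x ∉ D.locus) :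
    HasLogOn (fun w => w - (x / S.nu - x)⁻¹) (inverted D x) := by
  classical
  obtain ⟨G, hG, eG, hG0⟩ := S.exists_log_quotient hx
  have hxx : x / S.nu - x ≠ 0 := by
    have hx0 : x ≠ 0 := fun h => hx (D.mem_locus_iff.2 (Or.inl h))
    have hν1 : S.nu ≠ 1 := fun h => by simpa [h] using S.norm_nu_lt
    rw [sub_ne_zero, Ne, div_eq_iff S.nu_ne]
    intro h
    exact hν1 (mul_left_cancel₀ hx0 (by rw [mul_one]; exact h.symm))
  set q := (x / S.nu - x)⁻¹ with hq
  have hq0 : -q ≠ 0 := neg_ne_zero.2 (inv_ne_zero hxx)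
  let M : ℂ → ℂ := fun w => if w = 0 then 0 else G (x + w⁻¹)
  have hM : ContinuousOn M (inverted D x) := by
    intro w hw
    by_cases hw0 : w = 0
    · subst hw0
      have hM0 : M 0 = 0 := if_pos rfl
      rw [← continuousWithinAt_sdiff_self]
      show Tendsto M _ (𝓝 (M 0))
      rw [hM0]
      have h1 : Tendsto (fun w : ℂ => x + w⁻¹) (𝓝[inverted D x \ {0}] 0)
          (Bornology.cobounded ℂ ⊓ 𝓟 D.locus) := by
        refine tendsto_inf.2 ⟨?_, tendsto_principal.2 ?_⟩
        · have h2 : Tendsto (fun w : ℂ => w⁻¹) (𝓝[inverted D x \ {0}] 0)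
              (Bornology.cobounded ℂ) :=
            tendsto_inv₀_nhdsNE_zero.mono_left (nhdsWithin_mono _ fun z hz => hz.2)
          exact (tendsto_const_add_cobounded x).comp h2
        · filter_upwards [self_mem_nhdsWithin] with v hv using hv.1.resolve_left hv.2
      refine (hG0.comp h1).congr' ?_
      filter_upwards [self_mem_nhdsWithin] with v hv
      exact (if_neg hv.2).symm
    · have hwl : x + w⁻¹ ∈ D.locus := hw.resolve_left hw0
      have h1 : ContinuousWithinAt (fun w : ℂ => G (x + w⁻¹)) (inverted D x ∩ {0}ᶜ) w := by
        refine ContinuousWithinAt.comp (t := D.locus) (hG _ hwl) (f := fun w : ℂ => x + w⁻¹)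
          (ContinuousAt.continuousWithinAt (by fun_prop (disch := exact hw0)))
          fun v hv => hv.1.resolve_left hv.2
      have h2 : ContinuousWithinAt M (inverted D x ∩ {0}ᶜ) w :=
        h1.congr (fun v hv => if_neg hv.2) (if_neg hw0)
      exact h2.mono_of_mem_nhdsWithin (inter_mem self_mem_nhdsWithin
        (mem_nhdsWithin_of_mem_nhds (isOpen_ne.mem_nhds hw0)))
  refine ⟨fun w => Complex.log (-q) + M w, continuousOn_const.add hM, fun w hw => ?_⟩
  rw [Complex.exp_add, Complex.exp_log hq0]
  by_cases hw0 : w = 0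
  · simp [M, hw0]
  · simp only [M, if_neg hw0]
    rw [eG _ (hw.resolve_left hw0), add_sub_cancel_left, div_inv_eq_mul,
      show x + w⁻¹ - x / S.nu = w⁻¹ - (x / S.nu - x) by ring,
      show x / S.nu - x = q⁻¹ by rw [hq, inv_inv]]
    have := neg_ne_zero.1 hq0
    field_simp
    ring

/-- By Eilenberg's criterion the component of `q` off the inverted set is unbounded. Inverting back,
a connected set off the locus runs from `x / nu` to points close to `x`. -/
theorem joinedIn_compl_locus {x : ℂ} (hx : x ∉ D.locus) : JoinedIn D.locusᶜ (x / S.nu) x := by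
  have hxν : x / S.nu ∉ D.locus := fun h => hx (S.div_nu_mem_locus_iff.1 h)
  set q := (x / S.nu - x)⁻¹ with hq
  have hxq : x + q⁻¹ = x / S.nu := by rw [hq, inv_inv]; ring
  have hqK : q ∉ inverted D x := by
    rintro (h | h)
    · rw [h, inv_zero, add_zero] at hxq
      have hx0 : x ≠ 0 := fun h => hx (D.mem_locus_iff.2 (Or.inl h))
      have hν1 : S.nu ≠ 1 := fun h => by simpa [h] using S.norm_nu_lt
      rw [eq_div_iff S.nu_ne] at hxq
      exact hν1 (mul_left_cancel₀ hx0 (by rw [mul_one]; exact hxq))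
    · exact hxν (hxq ▸ h)
  have hunb := not_isBounded_component_of_hasLogOn (isCompact_inverted hx) hqK
    (S.hasLogOn_inverted hx)
  obtain ⟨r, hr, hball⟩ := exists_ball_subset hx
  obtain ⟨w, hw, hwr⟩ : ∃ w ∈ connectedComponentIn (inverted D x)ᶜ q, r⁻¹ < ‖w‖ := by
    by_contra! h
    exact hunb (isBounded_iff_forall_norm_le.2 ⟨r⁻¹, h⟩)
  set V := connectedComponentIn (inverted D x)ᶜ q with hV
  have hVs : ∀ v ∈ V, v ≠ 0 ∧ x + v⁻¹ ∉ D.locus := fun v hv => by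
    have := connectedComponentIn_subset _ _ hv
    simpa only [inverted, mem_compl_iff, mem_ofPred_eq, not_or] using this
  have hqV : q ∈ V := mem_connectedComponentIn hqK
  have hA : IsPreconnected ((fun v : ℂ => x + v⁻¹) '' V) :=
    isPreconnected_connectedComponentIn.image _
      (continuousOn_const.add (continuousOn_id.inv₀ fun v hv => (hVs v hv).1))
  have hwb : x + w⁻¹ ∈ Metric.ball x r := by
    rw [mem_ball_iff_norm, add_sub_cancel_left, norm_inv]
    exact inv_lt_of_inv_lt₀ hr hwr
  have hB := IsPreconnected.union (x + w⁻¹) (mem_image_of_mem (fun v : ℂ => x + v⁻¹) hw) hwb hA (convex_ball x r).isPreconnected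
  have hBs : (fun v : ℂ => x + v⁻¹) '' V ∪ Metric.ball x r ⊆ D.locusᶜ := by
    refine union_subset ?_ hball
    rintro _ ⟨v, hv, rfl⟩
    exact (hVs v hv).2
  have hsub := hB.subset_connectedComponentIn (Or.inr (Metric.mem_ball_self hr)) hBs
  have hopen : IsOpen (connectedComponentIn D.locusᶜ x) :=
    D.isClosed_locus.isOpen_compl.connectedComponentIn
  have hpc := hopen.isConnected_iff_isPathConnected.1 (isConnected_connectedComponentIn_iff.2 hx)
  exact (hpc.joinedIn _ (hsub (Or.inl ⟨q, hqV, hxq⟩)) _ (mem_connectedComponentIn hx)).mono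
    (connectedComponentIn_subset _ _)

end Links
end PeriodicTail

/-! ### The spiral in the complement of the locus. -/

namespace PeriodicTail

variable {D : PeriodicTail}

/-- A curve spiralling into `0` whose distance from the locus is comparable to its norm. -/
theorem exists_spiral (D : PeriodicTail) : ∃ y : ℝ → ℂ, Continuous y ∧ (∀ t, y t ≠ 0) ∧
    Tendsto y atTop (𝓝 0) ∧ ∃ η > 0, ∀ t, ∀ z ∈ D.locus, η * ‖y t‖ ≤ ‖y t - z‖ := by
  obtain ⟨S⟩ := D.nonempty_links
  obtain ⟨x, hx⟩ := D.exists_notMem_locus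
  have hJ := S.joinedIn_compl_locus hx
  let γ := hJ.somePath
  have hγ : ∀ t, γ t ∉ D.locus := hJ.somePath_mem
  have hν := S.nu_ne
  let κ := Complex.log S.nu
  have hκ : Complex.exp κ = S.nu := Complex.exp_log hν
  -- As `γ` runs from `x / nu` to `x`, the factor `exp (-κ t)` makes the end values equal, so `g`
  -- extends to a continuous function of period 1. Multiplying back by `exp (κ t)` places the copy
  -- `nu ^ n γ` on `[n, n + 1]`.
  let g : ℝ → ℂ := fun t => Complex.exp (-(κ * t)) * γ.extend t
  have hgc : Continuous g := by
    have := γ.continuous_extend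
    fun_prop
  have hg01 : g 0 = g 1 := by
    simp only [g, Path.extend_zero, Path.extend_one, Complex.exp_neg]
    simp only [Complex.ofReal_zero, mul_zero, Complex.exp_zero, Complex.ofReal_one, mul_one, hκ]
    rw [inv_one, one_mul, div_eq_inv_mul]
  let per : ℝ → ℂ := fun t => AddCircle.liftIco (1 : ℝ) 0 g (t : AddCircle (1 : ℝ))
  have : Fact ((0 : ℝ) < 1) := ⟨one_pos⟩
  have hperc : Continuous per :=
    (AddCircle.liftIco_zero_continuous hg01 hgc.continuousOn).comp (AddCircle.continuous_mk' 1)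
  have hper : ∀ t, per t = g (Int.fract t) := by
    intro t
    simp only [per]
    rw [← AddCircle.coe_fract t, AddCircle.liftIco_zero_coe_apply ⟨Int.fract_nonneg t, Int.fract_lt_one t⟩]
  let y : ℝ → ℂ := fun t => Complex.exp (κ * t) * per t
  have hy : ∀ t, y t = S.nu ^ ⌊t⌋ * γ.extend (Int.fract t) := by
    intro t
    simp only [y, hper, g]
    have hpow : S.nu ^ ⌊t⌋ = Complex.exp (⌊t⌋ * κ) := by rw [Complex.exp_int_mul, hκ]
    rw [← mul_assoc, ← Complex.exp_add, hpow]
    congr 2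
    have : (t : ℂ) = (⌊t⌋ : ℂ) + ((Int.fract t : ℝ) : ℂ) := by
      exact_mod_cast (Int.floor_add_fract t).symm
    linear_combination κ * this
  have hext : ∀ t, γ.extend t ∉ D.locus := by
    intro t
    obtain ⟨u, hu⟩ : γ.extend t ∈ range γ := by rw [← Path.extend_range]; exact mem_range_self t
    rw [← hu]; exact hγ u
  have h0 : (0 : ℂ) ∈ D.locus := D.mem_locus_iff.2 (Or.inl rfl)
  have hνn : ∀ n : ℤ, ∀ z, S.nu ^ n * z ∈ D.locus ↔ z ∈ D.locus := by
    intro n z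
    have : S.nu ^ n = D.lam ^ (D.p * (S.N * n) : ℤ) := by
      rw [Links.nu, ← zpow_mul]; congr 1; ring
    rw [this]
    exact D.mul_mem_locus_iff _
  have hcomp : IsCompact (range γ) := isCompact_range γ.continuous
  obtain ⟨R, hR⟩ := hcomp.isBounded.exists_norm_le
  obtain ⟨ε, hε, hthick⟩ := hcomp.exists_thickening_subset_open D.isClosed_locus.isOpen_compl
    (by rintro _ ⟨u, rfl⟩; exact hγ u)
  have hextR : ∀ t, γ.extend t ∈ range γ := fun t => by
    rw [← Path.extend_range]; exact mem_range_self t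
  have hR0 : 0 ≤ R := (norm_nonneg _).trans (hR _ (hextR 0))
  have hfar : ∀ t, ∀ z ∈ D.locus, ε ≤ ‖γ.extend t - z‖ := by
    intro t z hz
    by_contra! h
    refine hthick (Metric.mem_thickening_iff.2 ⟨_, hextR t, ?_⟩) hz
    rwa [dist_comm, dist_eq_norm]
  refine ⟨y, by fun_prop, fun t ht => ?_, ?_, ε / (R + 1), by positivity, fun t z hz => ?_⟩
  · have h1 : y t ∉ D.locus := by
      rw [hy, hνn]; exact hext _
    exact h1 (ht ▸ h0)
  · obtain ⟨B, hB⟩ := (isCompact_Icc (a := (0 : ℝ)) (b := 1)).image hgc |>.isBounded.exists_norm_le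
    have h1 : Tendsto (fun t : ℝ => Real.exp (κ.re * t) * B) atTop (𝓝 0) := by
      have h2 : κ.re < 0 := by
        simp only [κ, Complex.log_re]
        exact Real.log_neg (norm_pos_iff.2 hν) S.norm_nu_lt
      simpa using (Real.tendsto_exp_atBot.comp
        (tendsto_id.const_mul_atTop_of_neg h2)).mul_const B
    refine squeeze_zero_norm (fun t => ?_) h1
    simp only [y, hper]
    rw [norm_mul, Complex.norm_exp, Complex.re_mul_ofReal]
    exact mul_le_mul_of_nonneg_left
      (hB _ ⟨_, ⟨Int.fract_nonneg t, (Int.fract_lt_one t).le⟩, rfl⟩) (Real.exp_pos _).le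
  · have h1 : z = S.nu ^ ⌊t⌋ * ((S.nu ^ ⌊t⌋)⁻¹ * z) :=
      (mul_inv_cancel_left₀ (zpow_ne_zero _ hν) z).symm
    set w := (S.nu ^ ⌊t⌋)⁻¹ * z with hw
    have hwl : w ∈ D.locus := (hνn ⌊t⌋ w).1 (h1 ▸ hz)
    rw [hy, h1, ← mul_sub, norm_mul, norm_mul, mul_left_comm]
    refine mul_le_mul_of_nonneg_left ?_ (norm_nonneg _)
    refine le_trans ?_ (hfar _ w hwl)
    rw [div_mul_eq_mul_div, div_le_iff₀ (by positivity)]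
    exact mul_le_mul_of_nonneg_left ((hR _ (hextR _)).trans (by linarith)) hε.le

/-! ### Comparing series near `lam` with sub-sums at `lam`. -/

/-- The power series with coefficients `e`. -/
def series (e : ℕ → ℤ) (z : ℂ) : ℂ := ∑' n, (e n : ℂ) * z ^ n

/-- The coefficients of a series lie in `{-1, 0, 1}`. -/
def IsDigits (e : ℕ → ℤ) : Prop := ∀ n, e n = -1 ∨ e n = 0 ∨ e n = 1

lemma continuousOn_series_left (z : ℂ) (hz : ‖z‖ < 1) :
    ContinuousOn (fun e : ℕ → ℤ => series e z) {e | IsDigits e} := by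
  refine continuousOn_tsum (u := fun n => ‖z‖ ^ n) (fun n => ?_)
    (summable_geometric_of_lt_one (norm_nonneg _) hz)
    fun n e he => norm_digit_mul_pow_le (he n) z n
  have : Continuous fun x : ℤ => (x : ℂ) := continuous_of_discreteTopology
  exact ((this.comp (continuous_apply n)).mul continuous_const).continuousOn

lemma isCompact_isDigits : IsCompact {e : ℕ → ℤ | IsDigits e} := by
  have h : {e : ℕ → ℤ | IsDigits e} = univ.pi fun _ => ({-1, 0, 1} : Set ℤ) := by
    ext e; simp [IsDigits, Set.mem_pi]
  rw [h]
  exact isCompact_univ_pi fun _ => (Set.toFinite _).isCompact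

/-- The admissible sequences form a compact set in the product topology, the value at `lam` is
continuous on it, and by uniqueness of `c` it does not vanish there. -/
lemma exists_series_ge (D : PeriodicTail) (l : ℕ) : ∃ ε > 0, ∀ e : ℕ → ℤ, IsDigits e → e 0 = 1 →
    (∃ j ≤ l, e j ≠ D.c j) → ε ≤ ‖series e D.lam‖ := by
  let K : Set (ℕ → ℤ) := {e | IsDigits e} ∩ ({e | e 0 = 1} ∩ ⋃ j ∈ Iic l, {e | e j ≠ D.c j})
  have hK : IsCompact K := by
    refine isCompact_isDigits.inter_right (IsClosed.inter ?_ ?_)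
    · exact (isClosed_discrete ({1} : Set ℤ)).preimage
        (continuous_apply (A := fun _ : ℕ => ℤ) 0)
    · refine (finite_Iic l).isClosed_biUnion fun j _ => ?_
      exact (isClosed_discrete ({D.c j}ᶜ : Set ℤ)).preimage
        (continuous_apply (A := fun _ : ℕ => ℤ) j)
  have hmem : ∀ e : ℕ → ℤ, IsDigits e → e 0 = 1 → (∃ j ≤ l, e j ≠ D.c j) → e ∈ K := by
    rintro e h1 h2 ⟨j, hj, h3⟩
    exact ⟨h1, h2, mem_biUnion (mem_Iic.2 hj) h3⟩
  rcases K.eq_empty_or_nonempty with h | h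
  · exact ⟨1, one_pos, fun e h1 h2 h3 => by have := hmem e h1 h2 h3; rw [h] at this; exact this.elim⟩
  · obtain ⟨e₀, he₀, hmin⟩ := hK.exists_isMinOn h
      ((continuousOn_series_left D.lam D.norm_lt).mono inter_subset_left).norm
    refine ⟨‖series e₀ D.lam‖, norm_pos_iff.2 fun h0 => ?_, fun e h1 h2 h3 => hmin (hmem e h1 h2 h3)⟩
    have h4 := D.uniq e₀ he₀.2.1 he₀.1 h0
    obtain ⟨j, -, hj⟩ := mem_iUnion₂.1 he₀.2.2
    exact hj (congrFun h4 j)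

lemma norm_pow_sub_pow_le {r : ℝ} {z w : ℂ} (hz : ‖z‖ ≤ r) (hw : ‖w‖ ≤ r) (n : ℕ) :
    r * ‖z ^ n - w ^ n‖ ≤ n * r ^ n * ‖z - w‖ := by
  have hr : 0 ≤ r := (norm_nonneg z).trans hz
  induction n with
  | zero => simp
  | succ n ih =>
    have h1 : z ^ (n + 1) - w ^ (n + 1) = z * (z ^ n - w ^ n) + (z - w) * w ^ n := by ring
    have h2 : ‖w ^ n‖ ≤ r ^ n := by rw [norm_pow]; exact pow_le_pow_left₀ (norm_nonneg _) hw n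
    calc r * ‖z ^ (n + 1) - w ^ (n + 1)‖
        ≤ r * (‖z‖ * ‖z ^ n - w ^ n‖ + ‖z - w‖ * ‖w ^ n‖) := by
          rw [h1, ← norm_mul, ← norm_mul]
          exact mul_le_mul_of_nonneg_left (norm_add_le _ _) hr
      _ ≤ r * (r * ‖z ^ n - w ^ n‖ + ‖z - w‖ * r ^ n) := by gcongr
      _ = r * (r * ‖z ^ n - w ^ n‖) + r * (‖z - w‖ * r ^ n) := by ring
      _ ≤ r * (n * r ^ n * ‖z - w‖) + r * (‖z - w‖ * r ^ n) := by gcongr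
      _ = (n + 1 : ℕ) * r ^ (n + 1) * ‖z - w‖ := by push_cast; ring

lemma summable_succ_mul_geometric {r : ℝ} (h0 : 0 ≤ r) (h1 : r < 1) :
    Summable fun i : ℕ => ((i : ℝ) + 1) * r ^ i := by
  have h2 := summable_pow_mul_geometric_of_norm_lt_one 1
    (show ‖r‖ < 1 by rwa [Real.norm_of_nonneg h0])
  have h3 := h2.add (summable_geometric_of_lt_one h0 h1)
  refine h3.congr fun i => ?_
  simp only [pow_one]; ring

lemma series_eq_pow_mul {e : ℕ → ℤ} (he : IsDigits e) {j : ℕ} (hj : ∀ n < j, e n = 0) {z : ℂ}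
    (hz : ‖z‖ < 1) : series e z = z ^ j * ∑' i, (e (j + i) : ℂ) * z ^ i := by
  unfold series
  rw [← (summable_digits he hz).sum_add_tsum_nat_add j, Finset.sum_eq_zero, zero_add,
    ← tsum_mul_left]
  · refine tsum_congr fun i => ?_
    rw [add_comm i j, pow_add]; ring
  · intro n hn
    simp [hj n (Finset.mem_range.1 hn)]

/-- Term `i + j` contributes at most `(i + j) r ^ (i + j) ‖z - w‖`, and `i + j ≤ (i + 1) (j + 1)`
separates the two indices. The resulting constant depends only on `r₁`, not on `j` or `e`. -/
lemma norm_series_sub_le {e : ℕ → ℤ} (he : IsDigits e) {j : ℕ} (hj : ∀ n < j, e n = 0)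
    {r₁ r : ℝ} (hr0 : 0 < r) (hr : r ≤ r₁) (hr₁ : r₁ < 1) {z w : ℂ} (hz : ‖z‖ ≤ r) (hw : ‖w‖ ≤ r) :
    r * ‖series e z - series e w‖ ≤
      (∑' i : ℕ, ((i : ℝ) + 1) * r₁ ^ i) * ((j + 1) * r ^ j * ‖z - w‖) := by
  have hz1 : ‖z‖ < 1 := by linarith
  have hw1 : ‖w‖ < 1 := by linarith
  have hs := (summable_succ_mul_geometric (hr0.le.trans hr) hr₁)
  have h1 : series e z - series e w = ∑' i : ℕ, (e (i + j) : ℂ) * (z ^ (i + j) - w ^ (i + j)) := by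
    unfold series
    rw [← (summable_digits he hz1).tsum_sub (summable_digits he hw1),
      ← ((summable_digits he hz1).sub (summable_digits he hw1)).sum_add_tsum_nat_add j,
      Finset.sum_eq_zero, zero_add]
    · exact tsum_congr fun i => by ring
    · intro n hn
      simp [hj n (Finset.mem_range.1 hn)]
  have h2 : ‖(r : ℂ) * (series e z - series e w)‖ ≤
      (∑' i : ℕ, ((i : ℝ) + 1) * r₁ ^ i) * ((j + 1) * r ^ j * ‖z - w‖) := by
    rw [h1, ← tsum_mul_left]
    refine tsum_of_norm_bounded (hs.hasSum.mul_right _) fun i => ?_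
    have h3 := norm_pow_sub_pow_le hz hw (i + j)
    rw [norm_mul, norm_mul, Complex.norm_real, Real.norm_of_nonneg hr0.le]
    have h4 : ((i + j : ℕ) : ℝ) ≤ (i + 1) * (j + 1) := by
      push_cast
      nlinarith [(Nat.cast_nonneg i : (0 : ℝ) ≤ i), (Nat.cast_nonneg j : (0 : ℝ) ≤ j)]
    calc r * (‖(e (i + j) : ℂ)‖ * ‖z ^ (i + j) - w ^ (i + j)‖)
        ≤ r * (1 * ‖z ^ (i + j) - w ^ (i + j)‖) := by
          gcongr
          exact norm_digit_le (he _)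
      _ = r * ‖z ^ (i + j) - w ^ (i + j)‖ := by rw [one_mul]
      _ ≤ (i + j : ℕ) * r ^ (i + j) * ‖z - w‖ := h3
      _ ≤ ((i + 1) * (j + 1)) * (r₁ ^ i * r ^ j) * ‖z - w‖ := by
          rw [pow_add]
          gcongr
      _ = ((i : ℝ) + 1) * r₁ ^ i * ((j + 1) * r ^ j * ‖z - w‖) := by ring
  rwa [norm_mul, Complex.norm_real, Real.norm_of_nonneg hr0.le] at h2

/-- The `m`-th power of `(j + 1) δ` is at most `(j + 1) ^ m C r ^ j`, which settles all large `j`;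
the finitely many others only require `δ` small. -/
lemma exists_small_of_pow_le {r C θ : ℝ} (h0 : 0 < r) (h1 : r < 1) (hθ : 0 < θ) (m : ℕ) :
    ∃ ρ > 0, ∀ δ : ℝ, 0 ≤ δ → δ < ρ → ∀ j : ℕ, δ ^ m ≤ C * r ^ j → (j + 1) * δ < θ := by
  have h2 : Tendsto (fun j : ℕ => ((j : ℝ) + 1) ^ m * (C * r ^ j)) atTop (𝓝 0) := by
    have h3 := tendsto_pow_const_mul_const_pow_of_abs_lt_one m
      (show |r| < 1 by rwa [abs_of_pos h0])
    have h4 := (h3.comp (tendsto_add_atTop_nat 1)).const_mul (C / r)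
    rw [mul_zero] at h4
    refine h4.congr fun j => ?_
    simp only [Function.comp_apply]
    push_cast
    field_simp
    ring
  obtain ⟨J, hJ⟩ := eventually_atTop.1 (h2.eventually (gt_mem_nhds (pow_pos hθ m)))
  refine ⟨θ / (J + 1), by positivity, fun δ hδ0 hδ j hj => ?_⟩
  rcases lt_or_ge j J with hlt | hge
  · rw [lt_div_iff₀ (by positivity)] at hδ
    have : (j : ℝ) + 1 ≤ J + 1 := by
      have : (j : ℝ) ≤ J := by exact_mod_cast hlt.le
      linarith
    calc ((j : ℝ) + 1) * δ ≤ (J + 1) * δ := by gcongr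
      _ = δ * (J + 1) := mul_comm _ _
      _ < θ := hδ
  · refine lt_of_pow_lt_pow_left₀ m hθ.le ?_
    rw [mul_pow]
    exact (mul_le_mul_of_nonneg_left hj (by positivity)).trans_lt (hJ j hge)

/-- Near `lam`, a sign series cannot vanish at a point `z` for which half the value at `z` of the
series `c` is far from the locus. -/
theorem eventually_series_ne_zero (D : PeriodicTail) (l : ℕ)
    (hl : ∀ n : ℕ, l < n → D.d n = D.c n) {m : ℕ} {C : ℝ}
    (hm : ∀ᶠ z in 𝓝 D.lam, ‖z - D.lam‖ ^ m ≤ C * ‖series D.c z‖) {η : ℝ} (hη : 0 < η) :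
    ∀ᶠ z in 𝓝 D.lam, ∀ y, series D.c z = 2 * y → y ≠ 0 →
      (∀ x ∈ D.locus, η * ‖y‖ ≤ ‖y - x‖) →
      ∀ a : ℕ → ℤ, (∀ n, a n = -1 ∨ a n = 1) → series a z ≠ 0 := by
  obtain ⟨ε, hε, hge⟩ := D.exists_series_ge l
  obtain ⟨δ₀, hδ₀, hle⟩ := D.exists_le_norm_piece
  set q := ‖D.lam‖ with hq
  have hq0 : 0 < q := D.norm_pos
  have hq1 : q < 1 := D.norm_lt
  set r₁ := (1 + q) / 2 with hr₁
  have hr₁1 : r₁ < 1 := by rw [hr₁]; linarith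
  have hqr₁ : q < r₁ := by rw [hr₁]; linarith
  set B := ∑' i : ℕ, ((i : ℝ) + 1) * r₁ ^ i with hB
  have hB0 : 0 ≤ B := tsum_nonneg fun i => by positivity
  -- the tolerance for `(j + 1) * ‖z - lam‖`
  obtain ⟨θ, hθ, hθ1, hθ2, hθ3⟩ : ∃ θ > 0, θ ≤ q ∧ B * (Real.exp 1 * θ) < q * (δ₀ / 2) ∧
      B * (Real.exp 1 * θ) < q * (η * (δ₀ / 2)) := by
    have h1 : Tendsto (fun θ : ℝ => B * (Real.exp 1 * θ)) (𝓝[>] 0) (𝓝 0) := by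
      have : Continuous fun θ : ℝ => B * (Real.exp 1 * θ) := by fun_prop
      simpa using (this.tendsto 0).mono_left nhdsWithin_le_nhds
    have h2 := h1.eventually (gt_mem_nhds (show 0 < q * (δ₀ / 2) by positivity))
    have h3 := h1.eventually (gt_mem_nhds (show 0 < q * (η * (δ₀ / 2)) by positivity))
    have h4 : ∀ᶠ θ : ℝ in 𝓝[>] 0, θ < q := (gt_mem_nhds hq0).filter_mono nhdsWithin_le_nhds
    obtain ⟨θ, a1, a2, a3, a4⟩ := (h2.and (h3.and (h4.and self_mem_nhdsWithin))).exists
    exact ⟨θ, a4, a3.le, a1, a2⟩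
  -- The constant comes from `‖f z‖ = 2 ‖e z‖ ≤ 2 r₁ ^ j / (1 - r₁)` for a sub-sum `e` starting at
  -- `j`.
  obtain ⟨ρ, hρ, hsmall⟩ := exists_small_of_pow_le (C := C * (2 * (1 - r₁)⁻¹)) (hq0.trans hqr₁)
    hr₁1 hθ m
  have e1 : ∀ᶠ z in 𝓝 D.lam, ‖z - D.lam‖ < ρ := by
    have : ContinuousAt (fun z => ‖z - D.lam‖) D.lam := by fun_prop
    exact this.eventually (gt_mem_nhds (by simpa using hρ))
  have e2 : ∀ᶠ z in 𝓝 D.lam, ‖z - D.lam‖ < r₁ - q := by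
    have : ContinuousAt (fun z => ‖z - D.lam‖) D.lam := by fun_prop
    exact this.eventually (gt_mem_nhds (by simpa using sub_pos.2 hqr₁))
  have e3 : ∀ᶠ z in 𝓝 D.lam, B * ‖z - D.lam‖ < q * ε := by
    have : ContinuousAt (fun z => B * ‖z - D.lam‖) D.lam := by fun_prop
    exact this.eventually (gt_mem_nhds (by simpa using mul_pos hq0 hε))
  filter_upwards [hm, e1, e2, e3] with z hzm hz1 hz2 hz3 y hy hy0 hyl a ha haz
  set δ := ‖z - D.lam‖ with hδ
  have hδ0 : 0 ≤ δ := norm_nonneg _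
  have hzr : ‖z‖ ≤ q + δ := by
    have := norm_le_norm_add_norm_sub D.lam z
    rw [norm_sub_rev] at this; exact this
  have hqr : q ≤ q + δ := by linarith
  have hrr₁ : q + δ ≤ r₁ := by linarith
  have hz1' : ‖z‖ < 1 := by linarith
  -- normalize the sign of `a`
  wlog ha0 : a 0 = 1 generalizing a
  · refine this (fun n => -a n) (fun n => ?_) ?_ ?_
    · rcases ha n with h | h <;> simp [h]
    · unfold series at haz ⊢
      simp only [Int.cast_neg, neg_mul, tsum_neg, haz, neg_zero]
    · rcases ha 0 with h | h
      · simp [h]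
      · exact absurd h ha0
  have had : IsDigits a := fun n => by rcases ha n with h | h <;> simp [h]
  have hcd : IsDigits D.c := fun n => by rcases D.c_unit n with h | h <;> simp [h]
  -- Half the difference `c - a`: the sub-sum of `c` over the places where the signs disagree.
  let e : ℕ → ℤ := fun n => if a n = D.c n then 0 else D.c n
  have hed : IsDigits e := fun n => by
    simp only [e]; split_ifs
    · simp
    · exact hcd n
  have hye : y = series e z := by
    have h1 : series D.c z - series a z = 2 * series e z := by
      unfold series
      rw [← (summable_digits hcd hz1').tsum_sub (summable_digits had hz1'), ← tsum_mul_left]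
      refine tsum_congr fun n => ?_
      simp only [e]
      rcases ha n with h | h <;> rcases D.c_unit n with h' | h' <;> simp [h, h'] <;> ring
    rw [haz, sub_zero, hy] at h1
    exact mul_left_cancel₀ two_ne_zero h1
  have hex : ∃ n, a n ≠ D.c n := by
    by_contra! h
    refine hy0 ?_
    rw [hye]
    simp [series, e, h]
  classical
  let j := Nat.find hex
  have hj : a j ≠ D.c j := Nat.find_spec hex
  have hjmin : ∀ n < j, e n = 0 := fun n hn => by
    have := Nat.find_min hex hn
    simp only [e]
    rw [if_pos (not_not.1 this)]
  -- An early disagreement keeps `a` bounded away from 0 at `lam`, hence at `z`. After a late one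
  -- the coefficients of `e` are digits of `d`, so `e` at `lam` is a point of the locus that turns
  -- out to be too close to `y`.
  rcases le_or_gt j l with hjl | hjl
  · have h1 := hge a had ha0 ⟨j, hjl, hj⟩
    have h2 := norm_series_sub_le had (j := 0) (by simp) (by linarith) hrr₁ hr₁1 hzr hqr
    rw [haz, zero_sub, norm_neg] at h2
    simp only [Nat.cast_zero, zero_add, pow_zero, one_mul] at h2
    rw [← hδ, ← hB] at h2
    have h3 : q * ε ≤ (q + δ) * ‖series a D.lam‖ := by gcongr
    linarith
  · have hσ : series e D.lam ∈ D.piece j := by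
      rw [mem_piece_iff]
      refine ⟨fun i => decide (a (j + i) ≠ D.c (j + i)), by simpa using hj, ?_⟩
      rw [series_eq_pow_mul hed hjmin D.norm_lt, zpow_natCast]
      congr 1
      refine tsum_congr fun i => ?_
      congr 2
      have := hl (j + i) (by omega)
      push_cast at this
      simp only [e, digit, this]
      by_cases h : a (j + i) = D.c (j + i) <;> simp [h]
    have hyj : ‖series D.c z‖ ≤ 2 * (r₁ ^ j * (1 - r₁)⁻¹) := by
      rw [hy, hye, norm_mul, series_eq_pow_mul hed hjmin hz1', norm_mul, norm_pow]
      have h1 := norm_tsum_digits_le (e := fun i => e (j + i)) (fun i => hed _) hz1'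
      have h2 : (1 - ‖z‖)⁻¹ ≤ (1 - r₁)⁻¹ := by
        gcongr
        linarith
      have h3 : ‖z‖ ≤ r₁ := hzr.trans hrr₁
      simp only [Complex.norm_ofNat]
      gcongr
      exact h1.trans h2
    have hC : 0 ≤ C ∨ C < 0 := le_or_gt 0 C
    have hjδ : (j + 1) * δ < θ := by
      refine hsmall δ hδ0 hz1 j ?_
      rcases hC with hC | hC
      · calc δ ^ m ≤ C * ‖series D.c z‖ := hzm
          _ ≤ C * (2 * (r₁ ^ j * (1 - r₁)⁻¹)) := by gcongr
          _ = C * (2 * (1 - r₁)⁻¹) * r₁ ^ j := by ring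
      · exfalso
        have h1 : 0 ≤ C * ‖series D.c z‖ := (pow_nonneg hδ0 m).trans hzm
        have h2 : 0 < ‖series D.c z‖ := by
          rw [hy]; exact norm_pos_iff.2 (mul_ne_zero two_ne_zero hy0)
        nlinarith
    -- `(1 + δ / q) ^ j ≤ exp (j δ / q)`, and `j δ < θ ≤ q`; this is the source of the factor `exp
    -- 1` in the choice of `θ`.
    have hrj : (q + δ) ^ j ≤ Real.exp 1 * q ^ j := by
      have h1 : q + δ = q * (1 + δ / q) := by field_simp
      rw [h1, mul_pow, mul_comm]
      gcongr
      have h2 : 1 + δ / q ≤ Real.exp (δ / q) := by linarith [Real.add_one_le_exp (δ / q)]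
      calc (1 + δ / q) ^ j ≤ Real.exp (δ / q) ^ j := by gcongr
        _ = Real.exp (j * (δ / q)) := by rw [← Real.exp_nat_mul]
        _ ≤ Real.exp 1 := by
          gcongr
          rw [mul_div_assoc', div_le_one hq0]
          nlinarith
    have h2 := norm_series_sub_le hed hjmin (by linarith) hrr₁ hr₁1 hzr hqr
    rw [← hye, ← hB, ← hδ] at h2
    have h3 : q * ‖y - series e D.lam‖ ≤ B * (Real.exp 1 * θ) * q ^ j := by
      calc q * ‖y - series e D.lam‖ ≤ (q + δ) * ‖y - series e D.lam‖ := by gcongr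
        _ ≤ B * ((j + 1) * (q + δ) ^ j * δ) := h2
        _ = B * (((j + 1) * δ) * (q + δ) ^ j) := by ring
        _ ≤ B * (θ * (Real.exp 1 * q ^ j)) := by gcongr
        _ = B * (Real.exp 1 * θ) * q ^ j := by ring
    have hqj : 0 < q ^ j := pow_pos hq0 j
    have h4 : ‖y - series e D.lam‖ < δ₀ / 2 * q ^ j := by
      have : q * ‖y - series e D.lam‖ < q * (δ₀ / 2 * q ^ j) := by
        rw [← mul_assoc]
        exact h3.trans_lt (mul_lt_mul_of_pos_right hθ2 hqj)
      exact lt_of_mul_lt_mul_left this hq0.le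
    have h5 : ‖y - series e D.lam‖ < η * (δ₀ / 2 * q ^ j) := by
      have : q * ‖y - series e D.lam‖ < q * (η * (δ₀ / 2 * q ^ j)) := by
        calc _ ≤ _ := h3
          _ < q * (η * (δ₀ / 2)) * q ^ j := mul_lt_mul_of_pos_right hθ3 hqj
          _ = _ := by ring
      exact lt_of_mul_lt_mul_left this hq0.le
    have h6 := hle j _ hσ
    rw [zpow_natCast] at h6
    have h7 : δ₀ / 2 * q ^ j ≤ ‖y‖ := by
      have := norm_le_norm_add_norm_sub y (series e D.lam)
      linarith
    have h8 := hyl _ (D.mem_locus_iff.2 (Or.inr ⟨j, hσ⟩))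
    have h9 : η * (δ₀ / 2 * q ^ j) ≤ η * ‖y‖ := by gcongr
    linarith

/-! ### The local coordinate at `lam`, and accessibility. -/

lemma series_zero (e : ℕ → ℤ) : series e 0 = e 0 := by
  unfold series
  rw [tsum_eq_single 0 fun n hn => by simp [hn]]
  simp

lemma analyticAt_series {e : ℕ → ℤ} (he : IsDigits e) {z : ℂ} (hz : ‖z‖ < 1) :
    AnalyticAt ℂ (series e) z := by
  obtain ⟨r, hr, hr1⟩ := exists_between hz
  have h0 : 0 ≤ r := (norm_nonneg z).trans hr.le
  have : DifferentiableOn ℂ (series e) (Metric.ball 0 r) := by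
    refine Complex.differentiableOn_tsum_of_summable_norm (summable_geometric_of_lt_one h0 hr1)
      (fun i => by fun_prop) Metric.isOpen_ball fun i w hw => ?_
    refine (norm_digit_mul_pow_le (he i) w i).trans ?_
    rw [mem_ball_zero_iff] at hw
    gcongr
  exact this.analyticAt (Metric.isOpen_ball.mem_nhds (by simpa using hr))

lemma not_eventually_series_eq_zero {e : ℕ → ℤ} (he : IsDigits e) (h0 : e 0 ≠ 0) {z : ℂ}
    (hz : ‖z‖ < 1) : ¬ ∀ᶠ w in 𝓝 z, series e w = 0 := by
  intro h
  have h1 : AnalyticOnNhd ℂ (series e) (Metric.ball 0 1) := fun w hw =>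
    analyticAt_series he (by simpa using hw)
  have h2 := h1.eqOn_zero_of_preconnected_of_eventuallyEq_zero
    (convex_ball 0 1).isPreconnected (by simpa using hz) h (Metric.mem_ball_self one_pos)
  rw [series_zero] at h2
  exact h0 (Int.cast_eq_zero.1 h2)

/-- An analytic function with an isolated zero is, in a suitable local coordinate, a power. -/
lemma exists_local_root {f : ℂ → ℂ} {a : ℂ} (hf : AnalyticAt ℂ f a) (h0 : f a = 0)
    (hne : ¬ ∀ᶠ z in 𝓝 a, f z = 0) : ∃ m : ℕ, m ≠ 0 ∧
      (∃ C : ℝ, ∀ᶠ z in 𝓝 a, ‖z - a‖ ^ m ≤ C * ‖f z‖) ∧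
      ∃ ψ : ℂ → ℂ, ψ 0 = a ∧ (∀ᶠ w in 𝓝 0, ContinuousAt ψ w) ∧ ∀ᶠ w in 𝓝 0, f (ψ w) = w ^ m := by
  obtain ⟨m, g, hg, hga, hfg⟩ := hf.exists_eventuallyEq_pow_smul_nonzero_iff.2 hne
  simp only [smul_eq_mul] at hfg
  have hm : m ≠ 0 := by
    rintro rfl
    have := hfg.self_of_nhds
    rw [h0, pow_zero, one_mul] at this
    exact hga this.symm
  refine ⟨m, hm, ⟨2 / ‖g a‖, ?_⟩, ?_⟩
  · have hpos := norm_pos_iff.2 hga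
    have h1 : ∀ᶠ z in 𝓝 a, ‖g a‖ / 2 < ‖g z‖ :=
      hg.continuousAt.norm.eventually (lt_mem_nhds (by linarith))
    filter_upwards [hfg, h1] with z hz hz1
    rw [hz, norm_mul, norm_pow, div_mul_eq_mul_div, le_div_iff₀ hpos]
    have := mul_le_mul_of_nonneg_left hz1.le (pow_nonneg (norm_nonneg (z - a)) m)
    linarith
  · obtain ⟨A, hA⟩ := IsAlgClosed.exists_pow_nat_eq (g a) (Nat.pos_of_ne_zero hm)
    have hA0 : A ≠ 0 := by
      rintro rfl
      rw [zero_pow hm] at hA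
      exact hga hA.symm
    let h : ℂ → ℂ := fun z => A * Complex.exp (Complex.log (g z / g a) / m)
    have hs : g a / g a ∈ Complex.slitPlane := by
      rw [div_self hga]; exact Complex.one_mem_slitPlane
    have hq : AnalyticAt ℂ (fun z => g z / g a) a := hg.div analyticAt_const hga
    have hh : AnalyticAt ℂ h a :=
      analyticAt_const.mul (((hq.clog hs).div analyticAt_const (Nat.cast_ne_zero.2 hm)).cexp)
    have hpow : ∀ᶠ z in 𝓝 a, h z ^ m = g z := by
      filter_upwards [hg.continuousAt.eventually_ne hga] with z hz
      simp only [h]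
      rw [mul_pow, hA, ← Complex.exp_nat_mul, mul_div_cancel₀ _ (Nat.cast_ne_zero.2 hm),
        Complex.exp_log (div_ne_zero hz hga), mul_div_cancel₀ _ hga]
    let φ : ℂ → ℂ := fun z => (z - a) * h z
    have hφ : AnalyticAt ℂ φ a := (analyticAt_id.sub analyticAt_const).mul hh
    have hφa : φ a = 0 := by simp [φ]
    have hd : deriv φ a ≠ 0 := by
      have h1 : HasDerivAt φ (1 * h a + (a - a) * deriv h a) a :=
        ((hasDerivAt_id a).sub_const a).mul hh.differentiableAt.hasDerivAt
      rw [h1.deriv]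
      simp [h, hA0]
    let ψ := hφ.hasStrictDerivAt.localInverse φ (deriv φ a) a hd
    have hψ : AnalyticAt ℂ ψ (φ a) := hφ.analyticAt_localInverse hd
    have hψ0 : ψ (φ a) = a := HasStrictFDerivAt.localInverse_apply_image _
    have hri : ∀ᶠ w in 𝓝 (φ a), φ (ψ w) = w := HasStrictFDerivAt.eventually_right_inverse _
    rw [hφa] at hψ hψ0 hri
    refine ⟨ψ, hψ0, hψ.eventually_continuousAt, ?_⟩
    have ht : Tendsto ψ (𝓝 0) (𝓝 a) := by
      have := hψ.continuousAt.tendsto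
      rwa [hψ0] at this
    filter_upwards [hri, ht.eventually hfg, ht.eventually hpow] with w h1 h2 h3
    rw [h2, ← h3, ← mul_pow]
    exact congrArg (· ^ m) h1

lemma tendsto_div_one_sub : Tendsto (fun t : ℝ => t / (1 - t)) (𝓝[<] 1) atTop := by
  have h1 : Tendsto (fun t : ℝ => (1 - t)⁻¹) (𝓝[<] 1) atTop := by
    refine tendsto_inv_nhdsGT_zero.comp ?_
    refine tendsto_nhdsWithin_of_tendsto_nhds_of_eventually_within _ ?_ ?_
    · have : Continuous fun t : ℝ => 1 - t := by fun_prop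
      simpa using (this.tendsto 1).mono_left nhdsWithin_le_nhds
    · filter_upwards [self_mem_nhdsWithin] with t ht
      simpa using ht
  have h2 : Tendsto (fun t : ℝ => t) (𝓝[<] 1) (𝓝 1) := nhdsWithin_le_nhds
  exact h2.pos_mul_atTop one_pos h1

/-- A point of the Thurston set which is the limit of a path in its complement lies in the frontier
and is accessible. -/
theorem frontier_and_accessible {lam : ℂ} (hlam : lam ∈ thurstonSet) {θ : ℝ → ℂ} {s₀ : ℝ}
    (hc : ContinuousOn θ (Ici s₀)) (hlim : Tendsto θ atTop (𝓝 lam))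
    (hθ : ∀ s ≥ s₀, θ s ∈ unitDisk \ thurstonSet) :
    lam ∈ frontier thurstonSet ∧ ∃ U : Set ℂ,
      IsComponentOf U (unitDisk \ thurstonSet) ∧ IsAccessibleFrom lam U := by
  classical
  constructor
  · refine ⟨subset_closure hlam, fun hint => ?_⟩
    have h1 := hlim.eventually (isOpen_interior.mem_nhds hint)
    obtain ⟨s, hs1, hs2⟩ := (h1.and (eventually_ge_atTop s₀)).exists
    exact (hθ s hs2).2 (interior_subset hs1)
  · let σ : ℝ → ℝ := fun t => s₀ + t / (1 - t)
    have hσ : ∀ t ∈ Ico (0 : ℝ) 1, σ t ∈ Ici s₀ := fun t ht => by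
      have : 0 ≤ t / (1 - t) := div_nonneg ht.1 (by linarith [ht.2])
      simp only [σ, mem_Ici]; linarith
    have hσc : ContinuousOn σ (Ico 0 1) := by
      refine continuousOn_const.add (continuousOn_id.div (by fun_prop) fun t ht => ?_)
      have := ht.2
      exact (by linarith : (0 : ℝ) < 1 - t).ne'
    let γ : ℝ → ℂ := fun t => if t < 1 then θ (σ t) else lam
    have hγ : ∀ t ∈ Ico (0 : ℝ) 1, γ t = θ (σ t) := fun t ht => if_pos ht.2
    have hγc : ContinuousOn γ (Ico 0 1) := (hc.comp hσc hσ).congr hγ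
    have hγ1 : γ 1 = lam := if_neg (lt_irrefl _)
    have hγm : ∀ t ∈ Ico (0 : ℝ) 1, γ t ∈ unitDisk \ thurstonSet := fun t ht => by
      rw [hγ t ht]; exact hθ _ (hσ t ht)
    have h0 : (0 : ℝ) ∈ Ico (0 : ℝ) 1 := ⟨le_rfl, one_pos⟩
    refine ⟨connectedComponentIn (unitDisk \ thurstonSet) (γ 0), ⟨γ 0, hγm 0 h0, rfl⟩, γ, ?_, ?_,
      hγ1⟩
    · intro t ht
      rcases ht.2.lt_or_eq with hlt | rfl
      · refine (hγc t ⟨ht.1, hlt⟩).mono_of_mem_nhdsWithin ?_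
        filter_upwards [self_mem_nhdsWithin, mem_nhdsWithin_of_mem_nhds (Iio_mem_nhds hlt)] with
          s hs hs1 using ⟨hs.1, hs1⟩
      · have h1 : Tendsto γ (𝓝[<] 1) (𝓝 lam) := by
          have h2 : Tendsto σ (𝓝[<] 1) atTop :=
            tendsto_atTop_add_const_left _ _ tendsto_div_one_sub
          refine (hlim.comp h2).congr' ?_
          filter_upwards [self_mem_nhdsWithin] with t ht
          exact (if_pos ht).symm
        have h3 : ContinuousWithinAt γ (Iio 1) 1 := by
          rw [ContinuousWithinAt, hγ1]; exact h1
        exact (continuousWithinAt_insert_self.2 h3).mono fun s hs => by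
          rcases hs.2.lt_or_eq with h | h
          · exact Or.inr h
          · exact Or.inl h
    · intro t ht
      exact (isPreconnected_Ico.image γ hγc).subset_connectedComponentIn ⟨0, h0, rfl⟩
        (by rintro _ ⟨s, hs, rfl⟩; exact hγm s hs) ⟨t, ht, rfl⟩

lemma mem_thurstonSet_iff {z : ℂ} : z ∈ thurstonSet ↔
    ‖z‖ < 1 ∧ ∃ a : ℕ → ℤ, (∀ n, a n = -1 ∨ a n = 1) ∧ series a z = 0 := by
  simp only [thurstonSet, unitDisk, attractor, mem_ofPred_eq, mem_ball_zero_iff]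
  refine and_congr_right fun _ => ⟨?_, ?_⟩
  · rintro ⟨a, ha, h⟩
    classical
    refine ⟨fun n => if a n = -1 then -1 else 1, fun n => by simp only; split_ifs <;> simp, ?_⟩
    rw [h]
    refine tsum_congr fun n => ?_
    congr 1
    dsimp only
    split_ifs with h1
    · simp [h1]
    · simp [(ha n).resolve_left h1]
  · rintro ⟨a, ha, h⟩
    refine ⟨fun n => a n, fun n => ?_, h.symm⟩
    rcases ha n with h1 | h1 <;> simp [h1]

/-- Choosing a continuous `m`-th root of `2 y` along the spiral and applying the inverse coordinate
gives a path ending at `lam` on which the series of `c` has value `2 y`; there no sign series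
vanishes. -/
theorem frontier_and_accessible_of_tail (D : PeriodicTail) (l : ℕ)
    (hl : ∀ n : ℕ, l < n → D.d n = D.c n) : D.lam ∈ frontier thurstonSet ∧ ∃ U : Set ℂ,
      IsComponentOf U (unitDisk \ thurstonSet) ∧ IsAccessibleFrom D.lam U := by
  have hcd : IsDigits D.c := fun n => by rcases D.c_unit n with h | h <;> simp [h]
  obtain ⟨m, hm, ⟨C, hC⟩, ψ, hψ0, hψc, hψ⟩ := exists_local_root
    (analyticAt_series hcd D.norm_lt) D.c_sum
    (not_eventually_series_eq_zero hcd (D.c_ne 0) D.norm_lt)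
  obtain ⟨y, hyc, hy0, hylim, η, hη, hyη⟩ := D.exists_spiral
  have hav := D.eventually_series_ne_zero l hl hC hη
  obtain ⟨L, hL, eL⟩ := exists_log_of_ne_zero_line (h := fun t => 2 * y t) (by fun_prop)
    fun t => mul_ne_zero two_ne_zero (hy0 t)
  let w : ℝ → ℂ := fun t => Complex.exp (L t / m)
  have hwm : ∀ t, w t ^ m = 2 * y t := fun t => by
    simp only [w]
    rw [← Complex.exp_nat_mul, mul_div_cancel₀ _ (Nat.cast_ne_zero.2 hm), eL]
  have hw0 : Tendsto w atTop (𝓝 0) := by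
    have h1 : Tendsto (fun t => ‖w t‖ ^ m) atTop (𝓝 0) := by
      have h2 := (hylim.const_mul 2).norm
      simp only [mul_zero, norm_zero] at h2
      refine h2.congr fun t => ?_
      rw [← hwm, norm_pow]
    rw [tendsto_zero_iff_norm_tendsto_zero]
    rw [Metric.tendsto_nhds] at h1 ⊢
    intro ε hε
    filter_upwards [h1 (ε ^ m) (pow_pos hε m)] with t ht
    simp only [dist_zero_right, norm_pow, norm_norm] at ht ⊢
    exact lt_of_pow_lt_pow_left₀ m hε.le ht
  have hψt : Tendsto ψ (𝓝 0) (𝓝 D.lam) := by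
    have := hψc.self_of_nhds.tendsto
    rwa [hψ0] at this
  have hlim : Tendsto (fun t => ψ (w t)) atTop (𝓝 D.lam) := hψt.comp hw0
  have hdisk : ∀ᶠ z in 𝓝 D.lam, ‖z‖ < 1 :=
    continuous_norm.continuousAt.eventually (gt_mem_nhds D.norm_lt)
  obtain ⟨s₀, hs₀⟩ := eventually_atTop.1 ((hw0.eventually hψc).and ((hw0.eventually hψ).and
    ((hlim.eventually hav).and (hlim.eventually hdisk))))
  refine frontier_and_accessible (θ := fun t => ψ (w t)) (s₀ := s₀) ?_ ?_ hlim ?_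
  · exact mem_thurstonSet_iff.2 ⟨D.norm_lt, D.c, fun n => (D.c_unit n).symm, D.c_sum⟩
  · intro t ht
    have h1 : ContinuousAt w t := by fun_prop
    exact (ContinuousAt.comp (hs₀ t ht).1 h1).continuousWithinAt
  · intro t ht
    obtain ⟨-, h2, h3, h4⟩ := hs₀ t ht
    refine ⟨by simpa [unitDisk] using h4, fun hmem => ?_⟩
    obtain ⟨-, a, ha, haz⟩ := mem_thurstonSet_iff.1 hmem
    exact h3 (y t) (by rw [h2, hwm]) (hy0 t) (hyη t) a ha haz

/-! ### From the rational type to the periodic data. -/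

lemma eq_mod_of_eventually_periodic {c : ℕ → ℤ} {l p : ℕ} (hper : ∀ n, l < n → c (n + p) = c n)
    (i : ℕ) : c (l + 1 + i) = c (l + 1 + i % p) := by
  conv_lhs => rw [← Nat.mod_add_div i p]
  induction i / p with
  | zero => simp
  | succ k ih =>
    rw [← ih, ← hper (l + 1 + (i % p + p * k)) (by omega)]
    congr 1
    ring

/-- The data of a unique vanishing sign series with eventually periodic coefficients. -/
theorem exists_periodicTail {lam : ℂ} (hlam : ‖lam‖ < 1) {c : ℕ → ℤ} (c0 : c 0 = 1)
    (hc : ∀ n, c n = 1 ∨ c n = -1) (hsum : series c lam = 0)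
    (huniq : ∀ a : ℕ → ℤ, a 0 = 1 → IsDigits a → series a lam = 0 → a = c) {l p : ℕ} (hp : 0 < p)
    (hper : ∀ n, l < n → c (n + p) = c n) :
    ∃ D : PeriodicTail, D.lam = lam ∧ ∀ n : ℕ, l < n → D.d n = D.c n := by
  have hcd : IsDigits c := fun n => by rcases hc n with h | h <;> simp [h]
  have hpZ : (0 : ℤ) < p := by exact_mod_cast hp
  let d : ℤ → ℤ := fun k => c (l + 1 + ((k - (l + 1)) % p).toNat)
  have hd : ∀ n : ℕ, l < n → d n = c n := by
    intro n hn
    obtain ⟨i, rfl⟩ : ∃ i, n = l + 1 + i := ⟨n - (l + 1), by omega⟩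
    rw [eq_mod_of_eventually_periodic hper i]
    simp only [d]
    congr 2
    have : (((l + 1 + i : ℕ) : ℤ) - (l + 1)) = (i : ℤ) := by push_cast; ring
    rw [this, ← Int.natCast_mod, Int.toNat_natCast]
  have hdper : ∀ k, d (k + p) = d k := by
    intro k
    simp only [d]
    congr 3
    rw [show k + p - ((l : ℤ) + 1) = k - (l + 1) + p by ring, Int.add_emod_right]
  have hdmul : ∀ (k : ℤ) (m : ℕ), d (k + p * m) = d k := by
    intro k m
    induction m with
    | zero => simp
    | succ m ih => 
      rw [← ih, ← hdper (k + p * m)]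
      congr 1
      push_cast
      ring
  have hlam0 : lam ≠ 0 := by
    rintro rfl
    rw [series_zero, c0] at hsum
    simp at hsum
  refine ⟨⟨lam, c, d, p, hlam0, hlam, hp, c0, hc, hsum, huniq, fun k => hc _, hdper, ?_⟩, rfl, hd⟩
  intro j
  by_contra! h
  -- move to a tail of `c` itself
  obtain ⟨J, hJl, hJ⟩ : ∃ J : ℕ, l < J ∧ ∀ i, c (J + i) = c J * c i := by
    obtain ⟨K, hK⟩ : ∃ K : ℕ, (K : ℤ) = l + 1 + |j| :=
      ⟨l + 1 + j.natAbs, by push_cast; ring⟩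
    have hk : (l : ℤ) < j + p * K := by
      have h1 : (K : ℤ) ≤ p * K := le_mul_of_one_le_left (by positivity) (by omega)
      have h2 := neg_abs_le j
      linarith
    have hJ : (((j + p * K).toNat : ℕ) : ℤ) = j + p * K := Int.toNat_of_nonneg (by linarith)
    generalize (j + p * K).toNat = J at hJ
    refine ⟨J, by omega, fun i => ?_⟩
    rw [← hd _ (by omega), ← hd J (by omega), Nat.cast_add, hJ, hdmul, ← h i,
      ← hdmul (j + i) K]
    congr 1
    ring
  -- If the tail of `c` at `J` were proportional to `c`, its value at `lam` would be 0, so the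
  -- truncation of `c` before `J` would be a second normalized vanishing series.
  let a : ℕ → ℤ := fun n => if n < J then c n else 0
  have had : IsDigits a := fun n => by
    simp only [a]; split_ifs
    · exact hcd n
    · simp
  have ha : series a lam = 0 := by
    have h1 : series a lam = ∑ n ∈ Finset.range J, (c n : ℂ) * lam ^ n := by
      unfold series
      rw [tsum_eq_sum (s := Finset.range J) fun n hn => by
        simp [a, Finset.mem_range.not.1 hn]]
      refine Finset.sum_congr rfl fun n hn => ?_
      simp [a, Finset.mem_range.1 hn]
    have h2 := (summable_digits hcd hlam).sum_add_tsum_nat_add J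
    have h3 : ∑' i, (c (i + J) : ℂ) * lam ^ (i + J) = c J * lam ^ J * series c lam := by
      unfold series
      rw [← tsum_mul_left]
      refine tsum_congr fun i => ?_
      rw [add_comm i J, hJ i, pow_add]
      push_cast; ring
    rw [h3, hsum, mul_zero, add_zero] at h2
    rw [h1, h2]
    exact hsum
  have hac := huniq a (by simp only [a]; rw [if_pos (by omega), c0]) had ha
  have := congrFun hac J
  simp only [a, lt_irrefl, if_false] at this
  rcases hc J with h' | h' <;> simp [h'] at this

/-- Compare coefficients at `n + p`: this exceeds `l + p`, so the right-hand side contributes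
nothing. -/
lemma coeff_add_of_hasRationalForm {f : PowerSeries ℤ} {l p : ℕ} (h : HasRationalForm f l p)
    {n : ℕ} (hn : l < n) : PowerSeries.coeff (n + p) f = PowerSeries.coeff n f := by
  obtain ⟨hp, h⟩ := h
  have h1 := congrArg (PowerSeries.coeff (n + p)) h
  rw [mul_sub, mul_one, map_sub, PowerSeries.coeff_mul_X_pow, map_sub, map_sub] at h1
  have ht : ∀ k, l < k → PowerSeries.coeff k (taylorPoly f l : PowerSeries ℤ) = 0 := by
    intro k hk
    rw [Polynomial.coeff_coe, taylorPoly, PowerSeries.coeff_trunc, if_neg (by omega)]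
  rw [ht _ hn, ht _ (by omega), map_sum, Finset.sum_eq_zero] at h1
  · linarith
  · intro j hj
    rw [Finset.mem_Icc] at hj
    rw [PowerSeries.coeff_C_mul_X_pow, if_neg (by omega)]

end PeriodicTail

end ThurstonSet

end

theorem theorem4p6 (lam : ℂ) (hM : lam ∈ ThurstonSet.connectivityLocus)
    (him : lam.im ≠ 0) (hnorm : ‖lam‖ ≤ 1 / Real.sqrt 2)
    (f : PowerSeries ℤ) (hf : ThurstonSet.vanishingSeries lam = {f})
    (l p : ℕ) (hlp : ThurstonSet.IsRationalType f l p)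
    (hne : ∀ j, PowerSeries.coeff j f ≠ 0)
    (h1 : ∀ n, n ≤ p - 1 →
      1 / 2 * (‖lam ^ (l + 1 + n + 1)‖ / (1 - ‖lam‖)) <
        ‖Polynomial.aeval lam (ThurstonSet.taylorPoly f (l + 1 + n))‖)
    (h2 : ∀ n, n ≤ p - 1 →
      ‖lam ^ (l + 1 + n + 1)‖ / (1 - ‖lam‖) <
        ‖Polynomial.aeval lam (ThurstonSet.taylorPoly f (l + 1 + n))‖ +
          ‖Polynomial.aeval lam (ThurstonSet.taylorPoly f (l + 1 + n + 1))‖)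
    (h3 : ∀ n, n ≤ p - 1 → ∀ Q : Polynomial ℤ,
      ThurstonSet.taylorPoly f l + Polynomial.X ^ (l + 1) * Q =
        ThurstonSet.taylorPoly f (l + 1 + n) →
      ∀ P : Polynomial ℤ, P.natDegree ≤ n →
        (∀ j, P.coeff j = -1 ∨ P.coeff j = 0 ∨ P.coeff j = 1) → P ≠ Q →
        ‖Polynomial.aeval lam (ThurstonSet.taylorPoly f (l + 1 + n))‖ <
          ‖Polynomial.aeval lam (ThurstonSet.taylorPoly f l) +
            lam ^ (l + 1) * Polynomial.aeval lam P‖) :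
    lam ∈ frontier ThurstonSet.thurstonSet ∧
      ∃ U : Set ℂ,
        ThurstonSet.IsComponentOf U (ThurstonSet.unitDisk \ ThurstonSet.thurstonSet) ∧
          ThurstonSet.IsAccessibleFrom lam U := by
  have hlam : ‖lam‖ < 1 := by simpa [ThurstonSet.unitDisk] using hM.1
  have hfm : f ∈ ThurstonSet.vanishingSeries lam := hf ▸ Set.mem_singleton f
  obtain ⟨D, rfl, hD⟩ := ThurstonSet.PeriodicTail.exists_periodicTail (l := l) (p := p) hlam
    (c := fun n => PowerSeries.coeff n f) hfm.1.1
    (fun n => by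
      rcases hfm.1.2 n with h | h | h
      · exact Or.inr h
      · exact absurd h (hne n)
      · exact Or.inl h) hfm.2
    (fun a ha0 ha ha1 => by
      have hmem : PowerSeries.mk a ∈ ThurstonSet.vanishingSeries lam := by
        refine ⟨⟨by simpa using ha0, fun j => by simpa using ha j⟩, ?_⟩
        simpa [ThurstonSet.seriesValue, ThurstonSet.PeriodicTail.series] using ha1
      rw [hf] at hmem
      funext n
      rw [← Set.mem_singleton_iff.1 hmem, PowerSeries.coeff_mk])
    hlp.1.1 (fun n hn => ThurstonSet.PeriodicTail.coeff_add_of_hasRationalForm hlp.1 hn)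
  exact D.frontier_and_accessible_of_tail l hD
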